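/- Let $R$ be a Cohen–Macaulay local ring, that is, a commutative noetherian local ring whose depth equals its Krull dimension, and let $\widehat R$ be its completion with respect to its maximal ideal. Let $N$ be a finitely generated $\widehat R$-module that is free on the punctured spectrum of $\widehat R$, i.e. $N_{\mathfrak p}$ is a free $\widehat R_{\mathfrak p}$-module for every non-maximal prime ideal $\mathfrak p$ of $\widehat R$. Then there exists a finitely generated $R$-module $M$ that is free on the punctured spectrum of $R$, with $$\operatorname{depth}_R M=\operatorname{depth}_{\widehat R}N,$$ such that $N$ is isomorphic, as an $\widehat R$-module, to a direct summand of the completion $\widehat M$ of $M$ with respect to the maximal ideal of $R$. (Here the depth of a nonzero finitely generated module over a local ring is the supremum of the lengths of the regular sequences on it contained in the maximal ideal, and the zero module has depth $\infty$.) -/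

import Mathlib

open IsLocalRing

universe u v

/-- The depth of a module `M` over a local ring `R`: the supremum of the lengths of the
`M`-regular sequences in the maximal ideal. For a nonzero finitely generated `M`, a weakly regular
sequence in the maximal ideal is regular, by Nakayama; the zero module has depth `∞`. -/
noncomputable def moduleDepth (R : Type u) [CommRing R] [IsLocalRing R]
    (M : Type v) [AddCommGroup M] [Module R M] : ℕ∞ :=
  ⨆ rs : {rs : List R //
      RingTheory.Sequence.IsWeaklyRegular M rs ∧ ∀ r ∈ rs, r ∈ maximalIdeal R},
    (rs.1.length : ℕ∞)

/-- A noetherian local ring is Cohen-Macaulay if its depth equals its Krull dimension. -/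
def IsCohenMacaulayLocal (R : Type u) [CommRing R] [IsLocalRing R] [IsNoetherianRing R] : Prop :=
  (moduleDepth R R : WithBot ℕ∞) = ringKrullDim R

/-- `M` is free on the punctured spectrum of the local ring `R`: `M_p` is a free `R_p`-module for
every prime ideal `p` other than the maximal ideal. -/
def IsFreeOnPuncturedSpectrum (R : Type u) [CommRing R] [IsLocalRing R]
    (M : Type v) [AddCommGroup M] [Module R M] : Prop :=
  ∀ (p : Ideal R) [p.IsPrime], p ≠ maximalIdeal R →
    Module.Free (Localization.AtPrime p) (LocalizedModule p.primeCompl M)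

/-- `N` is isomorphic, as an `A`-module, to a direct summand of `M`. -/
def IsIsoToDirectSummand (A : Type*) [CommRing A] (N : Type*) [AddCommGroup N] [Module A N]
    (M : Type*) [AddCommGroup M] [Module A M] : Prop :=
  ∃ P Q : Submodule A M, IsCompl P Q ∧ Nonempty (N ≃ₗ[A] P)

/-! Write S for the completion and m for the maximal ideal of R. Say that an S-module descends if it
is S ⊗ M with M finite over R and free on the punctured spectrum. It suffices to find a finite Y
with depth Y ≥ depth N such that N ⊕ Y descends to some M: depth is unchanged by completion, so M
has the depth of N.

Finite S-modules killed by a power of m descend, since R and S agree modulo that power. Extensions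
of modules that descend also descend (`HasDescent.of_exact`): Ext¹ out of a finite module free on
the punctured spectrum is killed by a power of m, so completion does not change it. Let D be the
class of finite S-modules of depth at least n = depth N. The modules that descend after adding a
member of D are closed under extensions, syzygies and cancellation of members of D
(`HasStableDescent.isSyzygyClosed`). This needs D to contain the free modules, that is n ≤ depth S,
which is where the Cohen–Macaulay hypothesis enters.

Freeness of N on the punctured spectrum says that for some k every element of m^k S acts on N
through a finite free module. Let π : F → T be a finite free cover, x in S, and K the kernel of (π,
x) : F ⊕ T → T. On the one hand K is an extension of a syzygy of T/xT by the kernel of x on T, so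
iterating over generators x of m^k S reduces everything to modules killed by m^k S
(`IsSyzygyClosed.iteratedTwist_of_le`). On the other hand, if x acts on T through a free module,
then K is ker π ⊕ T, and ker π can be cancelled when T is in D (`IsSyzygyClosed.of_iteratedTwist`).
Taking T = N gives the complement Y. -/

namespace AdicCompletion

/-! ### Noetherianity and dimension of the completion. -/

section

variable {R : Type u} [CommRing R]

theorem exists_sub_algebraMap_mem_of_fg {I : Ideal R} (hI : I.FG) (k : ℕ)
    (s : AdicCompletion I R) :
    ∃ r : R, s - algebraMap R (AdicCompletion I R) r ∈
      (I ^ k).map (algebraMap R (AdicCompletion I R)) := by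
  obtain ⟨r, hr⟩ := Ideal.Quotient.mk_surjective (s.1 k)
  refine ⟨r, ?_⟩
  have : s - algebraMap R (AdicCompletion I R) r ∈
      (I ^ k • ⊤ : Submodule R (AdicCompletion I R)) := by
    rw [pow_smul_top_eq_ker_eval hI, AdicCompletion.algebraMap_apply, LinearMap.mem_ker, map_sub,
      sub_eq_zero]
    exact hr.symm
  rw [Ideal.smul_top_eq_map] at this
  exact this

/-- The completion is a quotient of a power series ring over R, with one variable for each generator
of I. The power series ring appears as the completion of the polynomial ring at its variables. -/
theorem isNoetherianRing [IsNoetherianRing R] (I : Ideal R) :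
    IsNoetherianRing (AdicCompletion I R) := by
  obtain ⟨s, hs⟩ := I.fg_of_isNoetherianRing
  let Q := MvPolynomial s R
  let φ : Q →+* R := MvPolynomial.eval (fun i : s ↦ (i : R))
  have hX : ∀ i, φ (MvPolynomial.X i) = i := fun i ↦ MvPolynomial.eval_X i
  have hC : ∀ r, φ (MvPolynomial.C r) = r := fun r ↦ MvPolynomial.eval_C r
  let J := MvPolynomial.idealOfVars s R
  have hJ : J.map φ = I := by
    simp only [J, MvPolynomial.idealOfVars, Ideal.map_span, ← Set.range_comp]
    rw [← hs]
    congr 1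
    ext x
    constructor
    · rintro ⟨a, rfl⟩
      rw [Function.comp_apply, hX]
      exact a.2
    · exact fun hx ↦ ⟨⟨x, hx⟩, hX _⟩
  have hJn : ∀ n, J ^ n ≤ (I ^ n).comap φ := fun n ↦ by
    rw [← Ideal.map_le_iff_le_comap, Ideal.map_pow, hJ]
  let f : ∀ n, AdicCompletion J Q →+* R ⧸ I ^ n := fun n ↦
    (Ideal.quotientMap (I ^ n) φ (hJn n)).comp (AdicCompletion.evalₐ J n : _ →+* _)
  have hf : ∀ {m n : ℕ} (hle : m ≤ n), (Ideal.Quotient.factorPow I hle).comp (f n) = f m := by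
    intro m n hle
    ext x
    induction x using AdicCompletion.induction_on with
    | h x =>
      have h := congrArg (Ideal.quotientMap (I ^ m) φ (hJn m))
        (AdicCompletion.Ideal.mk_eq_mk J hle x)
      simp only [f, RingHom.comp_apply, RingHom.coe_coe,
        Ideal.quotientMap_mk] at h ⊢
      exact h
  let F := AdicCompletion.liftRingHom I f hf
  have hF : ∀ q : Q, F (algebraMap Q _ q) = algebraMap R _ (φ q) := fun q ↦ by
    refine AdicCompletion.ext_evalₐ fun n ↦ ?_
    rw [AdicCompletion.evalₐ_liftRingHom, AlgHom.commutes]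
    simp only [f, RingHom.comp_apply, RingHom.coe_coe]
    rfl
  have hJF : (J.map (algebraMap Q (AdicCompletion J Q))).map F =
      I.map (algebraMap R (AdicCompletion I R)) := by
    have hcomp : F.comp (algebraMap Q (AdicCompletion J Q)) =
      (algebraMap R (AdicCompletion I R)).comp φ := RingHom.ext hF
    rw [Ideal.map_map, hcomp, ← Ideal.map_map, hJ]
  have := AdicCompletion.isAdicComplete_self J (MvPolynomial.idealOfVars_fg s R)
  have := AdicCompletion.isAdicComplete_self I I.fg_of_isNoetherianRing
  have hH : IsHausdorff ((J.map (algebraMap Q (AdicCompletion J Q))).map F)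
      (AdicCompletion I R) := by
    rw [hJF]; infer_instance
  -- Since the source is J-adically complete and the target is separated, surjectivity modulo J is
  -- enough.
  have hsurj : Function.Surjective F := by
    refine surjective_of_mk_map_comp_surjective
      (I := J.map (algebraMap Q (AdicCompletion J Q))) F fun y ↦ ?_
    obtain ⟨y, rfl⟩ := Ideal.Quotient.mk_surjective y
    obtain ⟨r, hr⟩ := exists_sub_algebraMap_mem_of_fg I.fg_of_isNoetherianRing 1 y
    refine ⟨algebraMap Q _ (MvPolynomial.C r), ?_⟩
    rw [RingHom.comp_apply, hF, eq_comm, Ideal.Quotient.mk_eq_mk_iff_sub_mem, hJF]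
    simpa [hC] using hr
  have : IsNoetherianRing (AdicCompletion J Q) :=
    isNoetherianRing_of_ringEquiv _ (MvPowerSeries.toAdicCompletionAlgEquiv s R).toRingEquiv
  exact isNoetherianRing_of_surjective _ _ F hsurj

end

section

variable {R : Type u} [CommRing R] [IsLocalRing R] [IsNoetherianRing R]

/-- The height inequality for the extension of R by its completion, whose closed fibre is a field
and contributes 0. -/
theorem ringKrullDim_le :
    ringKrullDim (AdicCompletion (maximalIdeal R) R) ≤ ringKrullDim R := by
  have := isNoetherianRing (maximalIdeal R)
  rw [← IsLocalRing.maximalIdeal_height_eq_ringKrullDim,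
    ← IsLocalRing.maximalIdeal_height_eq_ringKrullDim]
  have : (maximalIdeal (AdicCompletion (maximalIdeal R) R)).LiesOver (maximalIdeal R) :=
    ⟨(IsLocalRing.maximalIdeal_comap (algebraMap R (AdicCompletion (maximalIdeal R) R))).symm⟩
  have h := Ideal.height_le_height_add_of_liesOver (maximalIdeal R)
    (maximalIdeal (AdicCompletion (maximalIdeal R) R))
  have h0 : ((maximalIdeal (AdicCompletion (maximalIdeal R) R)).map (Ideal.Quotient.mk <|
      (maximalIdeal R).map (algebraMap R (AdicCompletion (maximalIdeal R) R)))).height = 0 := by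
    rw [← AdicCompletion.maximalIdeal_eq_map, Ideal.map_quotient_self]
    have : Nontrivial (AdicCompletion (maximalIdeal R) R ⧸
      maximalIdeal (AdicCompletion (maximalIdeal R) R)) := Ideal.Quotient.nontrivial_iff.mpr
        (maximalIdeal.isMaximal _).ne_top
    have := (Ideal.Quotient.isDomain (maximalIdeal (AdicCompletion (maximalIdeal R) R)))
    exact Ideal.height_bot
  rw [h0, add_zero] at h
  exact_mod_cast h

end

end AdicCompletion

/-! ### Multiplications that factor through a free module. -/

section StableAnnihilator

variable (A : Type*) [CommRing A]

/-- The ideal of all `a` such that multiplication by `a` on `M` factors through a finite free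
module. -/
def stableAnnihilator (M : Type*) [AddCommGroup M] [Module A M] : Ideal A where
  carrier := {a | ∃ (n : ℕ) (f : M →ₗ[A] (Fin n → A)) (g : (Fin n → A) →ₗ[A] M),
    g ∘ₗ f = a • LinearMap.id}
  zero_mem' := ⟨0, 0, 0, by simp⟩
  add_mem' := by
    rintro a b ⟨m, f, g, h⟩ ⟨n, f', g', h'⟩
    let e : (Fin (m + n) → A) ≃ₗ[A] (Fin m → A) × (Fin n → A) :=
      (LinearEquiv.funCongrLeft A A finSumFinEquiv) ≪≫ₗ
        LinearEquiv.sumArrowLequivProdArrow (Fin m) (Fin n) A A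
    refine ⟨m + n, e.symm.toLinearMap ∘ₗ f.prod f', (g.coprod g') ∘ₗ e.toLinearMap, ?_⟩
    ext x
    have h1 := LinearMap.congr_fun h x
    have h2 := LinearMap.congr_fun h' x
    simp only [LinearMap.comp_apply, LinearMap.smul_apply, LinearMap.id_apply] at h1 h2
    simp [h1, h2, add_smul]
  smul_mem' := by
    rintro c a ⟨n, f, g, h⟩
    refine ⟨n, f, c • g, ?_⟩
    rw [LinearMap.smul_comp, h, smul_smul, smul_eq_mul]

variable {A}
variable {M N P F : Type*} [AddCommGroup M] [Module A M] [AddCommGroup N] [Module A N]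
  [AddCommGroup P] [Module A P] [AddCommGroup F] [Module A F]

theorem mem_stableAnnihilator_of_comp_eq [Module.Free A F] [Module.Finite A F] {a : A}
    (f : M →ₗ[A] F) (g : F →ₗ[A] M) (h : g ∘ₗ f = a • LinearMap.id) :
    a ∈ stableAnnihilator A M := by
  rcases subsingleton_or_nontrivial A with _ | _
  · exact Subsingleton.elim 0 a ▸ zero_mem _
  let e := (Module.finBasis A F).equivFun
  refine ⟨_, e.toLinearMap ∘ₗ f, g ∘ₗ e.symm.toLinearMap, ?_⟩
  rw [← h]
  ext x
  simp

/-- If `a` stably annihilates `M`, then multiplication by `a` lifts along any surjection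
onto `M`. -/
theorem exists_lift_of_mem_stableAnnihilator {a : A} (ha : a ∈ stableAnnihilator A M)
    {p : N →ₗ[A] M} (hp : Function.Surjective p) :
    ∃ s : M →ₗ[A] N, p ∘ₗ s = a • LinearMap.id := by
  obtain ⟨n, f, g, h⟩ := ha
  obtain ⟨l, hl⟩ := Module.projective_lifting_property p g hp
  exact ⟨l ∘ₗ f, by rw [← LinearMap.comp_assoc, hl, h]⟩

/-- If `a` stably annihilates the cokernel of the injection `i`, then multiplication by `a`
extends along `i`. -/
theorem exists_extension_of_mem_stableAnnihilator {a : A} (ha : a ∈ stableAnnihilator A P)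
    {i : N →ₗ[A] M} {p : M →ₗ[A] P} (hi : Function.Injective i) (hip : Function.Exact i p)
    (hp : Function.Surjective p) :
    ∃ e : M →ₗ[A] N, e ∘ₗ i = a • LinearMap.id := by
  obtain ⟨s, hs⟩ := exists_lift_of_mem_stableAnnihilator ha hp
  have key : ∀ x, p (a • x - s (p x)) = 0 := fun x ↦ by
    have := LinearMap.congr_fun hs (p x)
    simp only [LinearMap.comp_apply, LinearMap.smul_apply, LinearMap.id_apply] at this
    simp [this]
  let e : M →ₗ[A] LinearMap.range i := LinearMap.codRestrict (LinearMap.range i)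
    (a • LinearMap.id - s ∘ₗ p) fun x ↦ (hip _).1 (by simpa using key x)
  refine ⟨(LinearEquiv.ofInjective i hi).symm.toLinearMap ∘ₗ e, ?_⟩
  ext x
  apply hi
  have : ((LinearEquiv.ofInjective i hi) ((LinearEquiv.ofInjective i hi).symm (e (i x))) : M) =
    e (i x) := by simp
  rw [LinearEquiv.ofInjective_apply] at this
  simp only [LinearMap.comp_apply, LinearEquiv.coe_coe, this]
  have h0 : (e (i x) : M) = a • i x - s (p (i x)) := rfl
  rw [h0, hip.apply_apply_eq_zero]
  simp

theorem stableAnnihilator_le_of_exact_of_free [Module.Free A F] [Module.Finite A F]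
    {i : N →ₗ[A] F} {p : F →ₗ[A] P} (hi : Function.Injective i) (hip : Function.Exact i p)
    (hp : Function.Surjective p) :
    stableAnnihilator A P ≤ stableAnnihilator A N := fun a ha ↦ by
  obtain ⟨e, he⟩ := exists_extension_of_mem_stableAnnihilator ha hi hip hp
  exact mem_stableAnnihilator_of_comp_eq i e he

/-- If b factors through a free module on P, lifting that factorization to M leaves a remainder with
values in N. Multiplying by a makes the remainder factor through a free module too. -/
theorem stableAnnihilator_mul_le_of_exact
    {i : N →ₗ[A] M} {p : M →ₗ[A] P} (hi : Function.Injective i) (hip : Function.Exact i p)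
    (hp : Function.Surjective p) :
    stableAnnihilator A N * stableAnnihilator A P ≤ stableAnnihilator A M := by
  rw [Ideal.mul_le]
  rintro a ha b ⟨n, f, g, hfg⟩
  obtain ⟨l, hl⟩ := Module.projective_lifting_property p g hp
  have key : ∀ x, p (b • x - l (f (p x))) = 0 := fun x ↦ by
    have h1 := LinearMap.congr_fun hl (f (p x))
    have h2 := LinearMap.congr_fun hfg (p x)
    simp only [LinearMap.comp_apply, LinearMap.smul_apply, LinearMap.id_apply] at h1 h2
    simp [h1, h2]
  let e : M →ₗ[A] LinearMap.range i := LinearMap.codRestrict (LinearMap.range i)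
    (b • LinearMap.id - l ∘ₗ f ∘ₗ p) fun x ↦ (hip _).1 (by simpa using key x)
  let e' := (LinearEquiv.ofInjective i hi).symm.toLinearMap ∘ₗ e
  have he' : ∀ x, i (e' x) = b • x - l (f (p x)) := fun x ↦ by
    have : ((LinearEquiv.ofInjective i hi) ((LinearEquiv.ofInjective i hi).symm (e x)) : M) =
      e x := by simp
    rw [LinearEquiv.ofInjective_apply] at this
    exact this
  obtain ⟨m, f', g', hfg'⟩ := ha
  refine mem_stableAnnihilator_of_comp_eq (F := (Fin m → A) × (Fin n → A))
    ((f' ∘ₗ e').prod (f ∘ₗ p)) ((i ∘ₗ g').coprod (a • l)) ?_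
  ext x
  have h1 := LinearMap.congr_fun hfg' (e' x)
  simp only [LinearMap.comp_apply, LinearMap.smul_apply, LinearMap.id_apply] at h1
  simp [h1, he', smul_sub, mul_smul]

theorem stableAnnihilator_le_of_equiv (e : M ≃ₗ[A] N) :
    stableAnnihilator A M ≤ stableAnnihilator A N := by
  rintro a ⟨n, f, g, h⟩
  refine ⟨n, f ∘ₗ e.symm.toLinearMap, e.toLinearMap ∘ₗ g, ?_⟩
  ext x
  have := LinearMap.congr_fun h (e.symm x)
  simp only [LinearMap.comp_apply, LinearMap.smul_apply, LinearMap.id_apply] at this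
  simp [this]

theorem annihilator_le_stableAnnihilator :
    Module.annihilator A M ≤ stableAnnihilator A M := fun a ha ↦ by
  refine ⟨0, 0, 0, ?_⟩
  ext x
  simpa using (Module.mem_annihilator.1 ha x).symm

theorem stableAnnihilator_eq_top_of_free [Module.Free A F] [Module.Finite A F] :
    stableAnnihilator A F = ⊤ :=
  (Ideal.eq_top_iff_one _).2 (mem_stableAnnihilator_of_comp_eq LinearMap.id LinearMap.id (by simp))

end StableAnnihilator

/-! ### The stable annihilator cuts out the non-free locus. -/

section LocallyFree

variable {A : Type u} [CommRing A] {M : Type v} [AddCommGroup M] [Module A M]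

theorem LocalizedModule.map_mk_apply {N : Type*} [AddCommGroup N] [Module A N] (T : Submonoid A)
    (f : M →ₗ[A] N) (m : M) (s : T) :
    LocalizedModule.map T f (LocalizedModule.mk m s) = LocalizedModule.mk (f m) s :=
  IsLocalizedModule.map_LocalizedModules T f m s

/-- An element a outside p becomes a unit, so the localized factorization exhibits the localization
of M as a retract of a free module; projective over a local ring is free. -/
theorem free_localizedModule_of_not_stableAnnihilator_le [Module.FinitePresentation A M]
    {p : Ideal A} [p.IsPrime] (h : ¬ stableAnnihilator A M ≤ p) :
    Module.Free (Localization.AtPrime p) (LocalizedModule p.primeCompl M) := by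
  obtain ⟨a, ⟨n, f, g, hfg⟩, hap⟩ := Set.not_subset.1 h
  let Ap := Localization.AtPrime p
  let T := p.primeCompl
  let f' : LocalizedModule T M →ₗ[Ap] LocalizedModule T (Fin n → A) := LocalizedModule.map T f
  let g' : LocalizedModule T (Fin n → A) →ₗ[Ap] LocalizedModule T M := LocalizedModule.map T g
  have hu : IsUnit (algebraMap A Ap a) := IsLocalization.map_units Ap (⟨a, hap⟩ : T)
  have hgf : ∀ x, g' (f' x) = algebraMap A Ap a • x := fun x ↦ by
    induction x using LocalizedModule.induction_on with
    | h m s =>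
      have h1 := LinearMap.congr_fun hfg m
      simp only [LinearMap.comp_apply, LinearMap.smul_apply, LinearMap.id_apply] at h1
      have hf' : f' (LocalizedModule.mk m s) = LocalizedModule.mk (f m) s :=
        LocalizedModule.map_mk_apply T f m s
      have hg' : g' (LocalizedModule.mk (f m) s) = LocalizedModule.mk (g (f m)) s :=
        LocalizedModule.map_mk_apply T g (f m) s
      rw [hf', hg', h1, algebraMap_smul, LocalizedModule.smul'_mk]
  have : Module.Projective Ap (LocalizedModule T (Fin n → A)) := inferInstance
  have hproj : Module.Projective Ap (LocalizedModule T M) := by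
    refine Module.Projective.of_split f' (((hu.unit⁻¹ : Apˣ) : Ap) • g') ?_
    ext x
    simp only [LinearMap.comp_apply, LinearMap.smul_apply, hgf, smul_smul]
    simp
  have : Module.Flat Ap (LocalizedModule T M) := inferInstance
  have : Module.Finite Ap (LocalizedModule T M) := inferInstance
  exact Module.free_of_flat_of_isLocalRing

/-- A localized free cover splits. Clearing denominators in the splitting gives a map l with π ∘ l
equal to multiplication by s, up to a further denominator for each generator of M. -/
theorem not_stableAnnihilator_le_of_free_localizedModule [Module.FinitePresentation A M]
    {p : Ideal A} [p.IsPrime]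
    (h : Module.Free (Localization.AtPrime p) (LocalizedModule p.primeCompl M)) :
    ¬ stableAnnihilator A M ≤ p := by
  let Ap := Localization.AtPrime p
  let T := p.primeCompl
  obtain ⟨n, π, hπ⟩ := Module.Finite.exists_fin' A M
  let π' : LocalizedModule T (Fin n → A) →ₗ[Ap] LocalizedModule T M := LocalizedModule.map T π
  have hπ' : Function.Surjective π' := LocalizedModule.map_surjective T π hπ
  obtain ⟨σ, hσ⟩ := Module.projective_lifting_property π' LinearMap.id hπ'
  let g : M →ₗ[A] LocalizedModule T (Fin n → A) :=
    σ.restrictScalars A ∘ₗ LocalizedModule.mkLinearMap T M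
  obtain ⟨l, s, hl⟩ := Module.FinitePresentation.exists_lift_of_isLocalizedModule T
    (LocalizedModule.mkLinearMap T (Fin n → A)) g
  have key : ∀ x, ∃ t : T, t • (π (l x)) = t • (s • x) := fun x ↦ by
    apply IsLocalizedModule.exists_of_eq (S := T) (f := LocalizedModule.mkLinearMap T M)
    have h1 := LinearMap.congr_fun hl x
    have h2 := congrArg π' h1
    have h3 := LinearMap.congr_fun hσ (LocalizedModule.mkLinearMap T M x)
    have h4 : π' (LocalizedModule.mkLinearMap T (Fin n → A) (l x)) =
        LocalizedModule.mkLinearMap T M (π (l x)) :=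
      LocalizedModule.map_mk_apply T π (l x) 1
    have h5 : π' ((s • g) x) = s • LocalizedModule.mkLinearMap T M x := by
      have : π' (g x) = LocalizedModule.mkLinearMap T M x := h3
      rw [← this]
      change π' ((s : A) • g x) = (s : A) • π' (g x)
      exact LinearMap.map_smul_of_tower π' (s : A) (g x)
    rw [LinearMap.comp_apply, h4, h5] at h2
    rw [h2]
    exact (LinearMap.map_smul_of_tower _ s x).symm
  choose t ht using key
  classical
  obtain ⟨G, hG⟩ := (Module.Finite.fg_top : (⊤ : Submodule A M).FG)
  let t₀ : T := ∏ x ∈ G, t x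
  intro hle
  have hmem : (t₀ * s : A) ∈ stableAnnihilator A M := by
    refine ⟨n, l, (t₀ : A) • π, ?_⟩
    have : Set.EqOn (((t₀ : A) • π) ∘ₗ l) (((t₀ * s : A)) • (LinearMap.id : M →ₗ[A] M))
        (G : Set M) := by
      intro x hx
      have hd : t₀ = (∏ y ∈ G.erase x, t y) * t x := (Finset.prod_erase_mul G t hx).symm
      have h1 : (t x : A) • π (l x) = (t x : A) • (s : A) • x := ht x
      have h2 : (t₀ : A) • π (l x) = (t₀ : A) • (s : A) • x := by
        rw [hd, Submonoid.coe_mul, mul_smul, h1, ← mul_smul]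
      simpa [mul_smul] using h2
    exact LinearMap.ext_on hG this
  exact (t₀ * s).2 (hle hmem)

end LocallyFree

section PuncturedSpectrum

variable {A : Type u} [CommRing A] [IsLocalRing A] [IsNoetherianRing A]
  {M : Type v} [AddCommGroup M] [Module A M] [Module.Finite A M]

theorem isFreeOnPuncturedSpectrum_iff :
    IsFreeOnPuncturedSpectrum A M ↔ ∃ k : ℕ, maximalIdeal A ^ k ≤ stableAnnihilator A M := by
  have := Module.finitePresentation_of_finite A M
  constructor
  · intro h
    have hrad : maximalIdeal A ≤ (stableAnnihilator A M).radical := by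
      rw [Ideal.radical_eq_sInf]
      refine le_sInf fun p ⟨hp, hprime⟩ ↦ ?_
      by_contra hne
      exact not_stableAnnihilator_le_of_free_localizedModule
        (h p fun h' ↦ hne h'.ge) hp
    exact Ideal.exists_pow_le_of_le_radical_of_fg hrad (maximalIdeal A).fg_of_isNoetherianRing
  · rintro ⟨k, hk⟩ p hp hne
    refine free_localizedModule_of_not_stableAnnihilator_le fun hle ↦ hne ?_
    exact ((maximalIdeal.isMaximal A).eq_of_le hp.ne_top
      (hp.le_of_pow_le (hk.trans hle))).symm

end PuncturedSpectrum

/-! ### Depth by vanishing of Ext, and its invariance under flat base change. -/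

section Depth

open CategoryTheory Abelian RingTheory.Sequence

section Basic

variable {A : Type u} [CommRing A] [IsLocalRing A] {M : Type*} [AddCommGroup M] [Module A M]

theorem le_moduleDepth_iff_exists (n : ℕ) :
    (n : ℕ∞) ≤ moduleDepth A M ↔
      ∃ rs : List A, rs.length = n ∧ IsWeaklyRegular M rs ∧ ∀ r ∈ rs, r ∈ maximalIdeal A := by
  constructor
  · intro h
    rcases n with _ | n
    · exact ⟨[], rfl, IsWeaklyRegular.nil A M, by simp⟩
    -- The supremum is not known to be attained, so a sequence longer than n is extracted and cut to
    -- length n + 1.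
    have h' : (n : ℕ∞) < moduleDepth A M :=
      lt_of_lt_of_le (by exact_mod_cast Nat.lt_succ_self n) h
    obtain ⟨⟨rs, hreg, hmem⟩, hlt⟩ := lt_iSup_iff.1 h'
    have hlt' : n + 1 ≤ rs.length := by exact_mod_cast hlt
    refine ⟨rs.take (n + 1), by simp [hlt'], ?_, fun r hr ↦ hmem r (List.mem_of_mem_take hr)⟩
    rw [← List.take_append_drop (n + 1) rs, isWeaklyRegular_append_iff] at hreg
    exact hreg.1
  · rintro ⟨rs, rfl, hreg, hmem⟩
    exact le_iSup (fun rs : {rs : List A //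
      IsWeaklyRegular M rs ∧ ∀ r ∈ rs, r ∈ maximalIdeal A} ↦ (rs.1.length : ℕ∞)) ⟨rs, hreg, hmem⟩

theorem moduleDepth_congr {N : Type*} [AddCommGroup N] [Module A N] (e : M ≃ₗ[A] N) :
    moduleDepth A M = moduleDepth A N := by
  refine ENat.eq_of_forall_natCast_le_iff fun n ↦ ?_
  simp_rw [le_moduleDepth_iff_exists, e.isWeaklyRegular_congr]

theorem moduleDepth_eq_top_of_subsingleton [Subsingleton M] : moduleDepth A M = ⊤ := by
  refine ENat.eq_top_iff_forall_ge.2 fun n ↦ (le_moduleDepth_iff_exists n).2 ?_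
  induction n with
  | zero => exact ⟨[], rfl, IsWeaklyRegular.nil A M, by simp⟩
  | succ n ih =>
    refine ⟨List.replicate (n + 1) 0, by simp, ?_, by simp⟩
    rw [isWeaklyRegular_iff]
    intro i hi x y _
    exact Subsingleton.elim _ _

/-- A regular sequence lowers the dimension of the support by its length, and what remains is
nonnegative. -/
theorem moduleDepth_le_ringKrullDim [IsNoetherianRing A] [Module.Finite A M] [Nontrivial M] :
    (moduleDepth A M : WithBot ℕ∞) ≤ ringKrullDim A := by
  refine WithBot.coe_le_iff.2 ?_
  obtain ⟨d, hd⟩ := WithBot.ne_bot_iff_exists.1 (ringKrullDim_ne_bot (R := A))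
  refine ⟨d, hd.symm, ENat.forall_natCast_le_iff_le.1 fun n hn ↦ ?_⟩
  obtain ⟨rs, rfl, hreg, hmem⟩ := (le_moduleDepth_iff_exists n).1 hn
  have hreg' := (isRegular_iff_isWeaklyRegular_of_subset_maximalIdeal hmem).2 hreg
  have h := Module.supportDim_add_length_eq_supportDim_of_isRegular rs hreg'
  have := hreg'.quot_ofList_smul_nontrivial ⊤
  have h0 : 0 ≤ Module.supportDim A (M ⧸ Ideal.ofList rs • (⊤ : Submodule A M)) := by
    obtain ⟨e, he⟩ := WithBot.ne_bot_iff_exists.1 (Module.supportDim_ne_bot_of_nontrivial A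
      (M ⧸ Ideal.ofList rs • (⊤ : Submodule A M)))
    rw [← he]
    exact_mod_cast zero_le (a := e)
  have h1 : (rs.length : WithBot ℕ∞) ≤ Module.supportDim A M := by
    rw [← h]
    exact le_add_of_nonneg_left h0
  have h2 := h1.trans (Module.supportDim_le_ringKrullDim A M)
  rw [← hd] at h2
  exact_mod_cast h2

end Basic

variable {A : Type u} [CommRing A] [IsLocalRing A]

variable (A) in
/-- The vanishing of `Extⁱ(k, M)` for `i < n`, where `k` is the residue field of `A`. -/
def ExtResidueVanish (n : ℕ) (M : Type u) [AddCommGroup M] [Module A M] : Prop :=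
  ∀ i < n, Subsingleton (Ext (ModuleCat.of A (A ⧸ maximalIdeal A)) (ModuleCat.of A M) i)

variable {M N P : Type u} [AddCommGroup M] [Module A M] [AddCommGroup N] [Module A N]
  [AddCommGroup P] [Module A P] {n : ℕ}

/-- Rees's characterization of depth. It makes depth inequalities follow from long exact sequences,
with no choice of regular sequence; the zero module fits because its depth is infinite. -/
theorem le_moduleDepth_iff [IsNoetherianRing A] [Module.Finite A M] :
    (n : ℕ∞) ≤ moduleDepth A M ↔ ExtResidueVanish A n M := by
  rcases subsingleton_or_nontrivial M with h | h
  · simp only [moduleDepth_eq_top_of_subsingleton, le_top, true_iff]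
    intro i _
    have h0 : (𝟙 (ModuleCat.of A M)) = 0 := (ModuleCat.isZero_of_subsingleton _).eq_of_src _ _
    refine subsingleton_of_forall_eq 0 fun x ↦ ?_
    rw [← x.comp_mk₀_id, h0, Ext.mk₀_zero, Ext.comp_zero]
  · rw [le_moduleDepth_iff_exists]
    have hlt : maximalIdeal A • (⊤ : Submodule A M) < ⊤ := lt_top_iff_ne_top.2
      (Submodule.top_ne_ideal_smul_of_le_jacobson_annihilator (maximalIdeal_le_jacobson _)).symm
    constructor
    · rintro ⟨rs, rfl, hreg, hmem⟩
      refine ModuleCat.subsingleton_ext_of_exists_isRegular (maximalIdeal A) _ ?_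
        (ModuleCat.of A M) hlt rs hmem ((isRegular_iff_isWeaklyRegular_of_subset_maximalIdeal hmem).2 hreg)
      rw [Module.support_eq_zeroLocus, Ideal.annihilator_quotient]
    · intro h
      obtain ⟨rs, hlen, hmem, hreg⟩ := ModuleCat.exists_isRegular_of_exists_subsingleton_ext
        (maximalIdeal A) n (ModuleCat.of A M) hlt (ModuleCat.of A (A ⧸ maximalIdeal A))
        (by rw [Module.support_eq_zeroLocus, Ideal.annihilator_quotient]) h
      exact ⟨rs, hlen, hreg.1, hmem⟩

namespace ExtResidueVanish

theorem of_exact_left {f : M →ₗ[A] N} {g : N →ₗ[A] P} (hf : Function.Injective f)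
    (hfg : Function.Exact f g) (hg : Function.Surjective g)
    (hN : ExtResidueVanish A n N) (hP : ExtResidueVanish A n P) : ExtResidueVanish A n M := by
  intro i hi
  have hS := ModuleCat.shortComplex_shortExact
    (ModuleCat.shortComplexOfCompEqZero f g hfg.linearMap_comp_eq_zero) hfg hf hg
  have := hS.mono_f
  refine subsingleton_of_forall_eq 0 fun x ↦ ?_
  have hx : x.comp (Ext.mk₀ (ModuleCat.shortComplexOfCompEqZero f g
    hfg.linearMap_comp_eq_zero).f) (add_zero i) = 0 := (hN i hi).elim _ _
  rcases i with _ | j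
  · exact Ext.postcomp_mk₀_injective_of_mono _ _ (hx.trans (by simp))
  · obtain ⟨y, rfl⟩ := Ext.covariant_sequence_exact₁ _ hS x hx rfl
    rw [(hP j (by omega)).elim y 0, Ext.zero_comp]

theorem of_exact_middle {f : M →ₗ[A] N} {g : N →ₗ[A] P} (hf : Function.Injective f)
    (hfg : Function.Exact f g) (hg : Function.Surjective g)
    (hM : ExtResidueVanish A n M) (hP : ExtResidueVanish A n P) : ExtResidueVanish A n N := by
  intro i hi
  have hS := ModuleCat.shortComplex_shortExact
    (ModuleCat.shortComplexOfCompEqZero f g hfg.linearMap_comp_eq_zero) hfg hf hg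
  refine subsingleton_of_forall_eq 0 fun x ↦ ?_
  obtain ⟨y, rfl⟩ := Ext.covariant_sequence_exact₂ _ hS x ((hP i hi).elim _ _)
  rw [(hM i hi).elim y 0, Ext.zero_comp]

theorem of_exact_right {f : M →ₗ[A] N} {g : N →ₗ[A] P} (hf : Function.Injective f)
    (hfg : Function.Exact f g) (hg : Function.Surjective g)
    (hM : ExtResidueVanish A (n + 1) M) (hN : ExtResidueVanish A n N) :
    ExtResidueVanish A n P := by
  intro i hi
  have hS := ModuleCat.shortComplex_shortExact
    (ModuleCat.shortComplexOfCompEqZero f g hfg.linearMap_comp_eq_zero) hfg hf hg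
  refine subsingleton_of_forall_eq 0 fun x ↦ ?_
  obtain ⟨y, rfl⟩ := Ext.covariant_sequence_exact₃ _ hS x rfl ((hM (i + 1) (by omega)).elim _ _)
  rw [(hN i hi).elim y 0, Ext.zero_comp]

theorem of_retract (f : M →ₗ[A] N) (g : N →ₗ[A] M) (h : g ∘ₗ f = LinearMap.id)
    (hN : ExtResidueVanish A n N) : ExtResidueVanish A n M := by
  intro i hi
  refine subsingleton_of_forall_eq 0 fun x ↦ ?_
  have h1 : x.comp (Ext.mk₀ (ModuleCat.ofHom f)) (add_zero i) = 0 := (hN i hi).elim _ _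
  have h2 := congrArg (fun y ↦ y.comp (Ext.mk₀ (ModuleCat.ofHom g)) (add_zero i)) h1
  simpa [← ModuleCat.ofHom_comp, h] using h2

theorem mono {m : ℕ} (h : ExtResidueVanish A n M) (hmn : m ≤ n) : ExtResidueVanish A m M :=
  fun i hi ↦ h i (hi.trans_le hmn)

theorem prod (hM : ExtResidueVanish A n M) (hN : ExtResidueVanish A n N) :
    ExtResidueVanish A n (M × N) :=
  of_exact_middle (f := LinearMap.inl A M N) (g := LinearMap.snd A M N) LinearMap.inl_injective
    Function.Exact.inl_snd LinearMap.snd_surjective hM hN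

theorem pi_fin (m : ℕ) (hM : ExtResidueVanish A n M) : ExtResidueVanish A n (Fin m → M) := by
  induction m with
  | zero =>
    exact of_retract (M := Fin 0 → M) (N := M) 0 0 (LinearMap.ext fun x ↦ Subsingleton.elim _ _) hM
  | succ m ih =>
    let e := Fin.consLinearEquiv A (fun _ : Fin (m + 1) ↦ M)
    exact of_retract e.symm.toLinearMap e.toLinearMap (by ext x; simp) (hM.prod ih)

theorem of_free {F : Type u} [AddCommGroup F] [Module A F] [Module.Free A F] [Module.Finite A F]
    (hA : ExtResidueVanish A n A) : ExtResidueVanish A n F :=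
  of_retract (Module.finBasis A F).equivFun.toLinearMap
    (Module.finBasis A F).equivFun.symm.toLinearMap (by ext x; simp) (hA.pi_fin _)

end ExtResidueVanish

section BaseChange

open scoped TensorProduct Pointwise

variable {R S : Type u} [CommRing R] [IsLocalRing R] [CommRing S] [IsLocalRing S]
  [Algebra R S] [Module.FaithfullyFlat R S]

theorem moduleDepth_le_moduleDepth_tensorProduct
    (hmap : (maximalIdeal R).map (algebraMap R S) = maximalIdeal S)
    (M : Type u) [AddCommGroup M] [Module R M] :
    moduleDepth R M ≤ moduleDepth S (S ⊗[R] M) := by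
  refine ENat.forall_natCast_le_iff_le.1 fun n hn ↦ ?_
  obtain ⟨rs, hlen, hreg, hmem⟩ := (le_moduleDepth_iff_exists n).1 hn
  refine (le_moduleDepth_iff_exists n).2 ⟨rs.map (algebraMap R S), by simpa using hlen,
    hreg.of_flat_of_isBaseChange (TensorProduct.isBaseChange R M S), fun r hr ↦ ?_⟩
  obtain ⟨x, hx, rfl⟩ := List.mem_map.1 hr
  exact hmap ▸ Ideal.mem_map_of_mem _ (hmem x hx)

variable [IsNoetherianRing R] [IsNoetherianRing S]

theorem le_moduleDepth_of_le_moduleDepth_tensorProduct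
    (hmap : (maximalIdeal R).map (algebraMap R S) = maximalIdeal S) (n : ℕ)
    (M : Type u) [AddCommGroup M] [Module R M] [Module.Finite R M]
    (h : (n : ℕ∞) ≤ moduleDepth S (S ⊗[R] M)) : (n : ℕ∞) ≤ moduleDepth R M := by
  induction n generalizing M with
  | zero => simp
  | succ n ih =>
    have hreg : ∃ x ∈ maximalIdeal R, IsSMulRegular M x := by
      -- A nonzero f would give, by faithful flatness, a nonzero element 1 ⊗ f 1 killed by the
      -- maximal ideal of S, against the regularity of the first member of the sequence over S.
      have hsub : Subsingleton ((R ⧸ maximalIdeal R) →ₗ[R] M) := by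
        refine subsingleton_of_forall_eq 0 fun f ↦ ?_
        have hk : ∀ r ∈ maximalIdeal R, r • f 1 = 0 := fun r hr ↦ by
          rw [← map_smul, Algebra.smul_def, mul_one]
          have : algebraMap R (R ⧸ maximalIdeal R) r = 0 := Ideal.Quotient.eq_zero_iff_mem.2 hr
          rw [this, map_zero]
        have hk' : ∀ s ∈ maximalIdeal S, s • ((1 : S) ⊗ₜ[R] f 1) = 0 := fun s hs ↦ by
          have hle : maximalIdeal S ≤ LinearMap.ker (LinearMap.toSpanSingleton S (S ⊗[R] M)
            ((1 : S) ⊗ₜ[R] f 1)) := by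
            rw [← hmap, Ideal.map_le_iff_le_comap]
            intro r hr
            simp [TensorProduct.smul_tmul', Algebra.algebraMap_eq_smul_one,
              hk r hr, TensorProduct.smul_tmul]
          exact hle hs
        obtain ⟨rs, hlen, hreg, hmem⟩ := (le_moduleDepth_iff_exists (n + 1)).1 h
        obtain ⟨r, rs, rfl⟩ := List.exists_cons_of_length_eq_add_one hlen
        have hr := ((isWeaklyRegular_cons_iff _ _ _).1 hreg).1
        have h0 : (1 : S) ⊗ₜ[R] f 1 = 0 :=
          hr.right_eq_zero_of_smul (hk' r (hmem r (by simp)))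
        have h1 : f 1 = 0 := Module.FaithfullyFlat.tensorProduct_mk_injective (A := R) (B := S) M
          (by simpa using h0)
        ext
        simpa using h1
      obtain ⟨x, hx, hx'⟩ := IsSMulRegular.subsingleton_linearMap_iff.1 hsub
      rw [Ideal.annihilator_quotient] at hx
      exact ⟨x, hx, hx'⟩
    obtain ⟨x, hx, hreg⟩ := hreg
    have hreg' : IsSMulRegular (S ⊗[R] M) (algebraMap R S x) :=
      hreg.of_flat_of_isBaseChange (TensorProduct.isBaseChange R M S)
    have hE : ExtResidueVanish S (n + 1) (S ⊗[R] M) := le_moduleDepth_iff.1 h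
    -- The given sequence over S need not begin with x, so the depth of the quotient is bounded
    -- through Ext.
    have hQ : ExtResidueVanish S n (QuotSMulTop (algebraMap R S x) (S ⊗[R] M)) :=
      ExtResidueVanish.of_exact_right (f := LinearMap.lsmul S (S ⊗[R] M) (algebraMap R S x))
        (g := (algebraMap R S x • (⊤ : Submodule S (S ⊗[R] M))).mkQ) hreg'
        (LinearMap.exact_lsmul_mkQ_smul_top _ _) (Submodule.mkQ_surjective _) hE
        (hE.mono n.le_succ)
    have hQ' := le_moduleDepth_iff.2 hQ
    rw [moduleDepth_congr (QuotSMulTop.algebraMapTensorEquivTensorQuotSMulTop x M S)] at hQ'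
    obtain ⟨rs, hlen, hrs, hmem⟩ := (le_moduleDepth_iff_exists n).1 (ih _ hQ')
    refine (le_moduleDepth_iff_exists (n + 1)).2 ⟨x :: rs, by simpa using hlen, hrs.cons hreg, ?_⟩
    simpa using ⟨hx, hmem⟩

theorem moduleDepth_tensorProduct
    (hmap : (maximalIdeal R).map (algebraMap R S) = maximalIdeal S)
    (M : Type u) [AddCommGroup M] [Module R M] [Module.Finite R M] :
    moduleDepth S (S ⊗[R] M) = moduleDepth R M :=
  le_antisymm (ENat.forall_natCast_le_iff_le.1 fun n hn ↦
    le_moduleDepth_of_le_moduleDepth_tensorProduct hmap n M hn)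
    (moduleDepth_le_moduleDepth_tensorProduct hmap M)

end BaseChange

end Depth

/-! ### Homomorphisms and flat base change. -/

section HomBaseChange

open scoped TensorProduct

variable {R : Type*} (S : Type*) [CommRing R] [CommRing S] [Algebra R S]

theorem linearMapRightBaseChangeHom_lTensor_lcomp {X Y M : Type*} [AddCommGroup X] [Module R X]
    [AddCommGroup Y] [Module R Y] [AddCommGroup M] [Module R M]
    (f : X →ₗ[R] Y) (t : S ⊗[R] (Y →ₗ[R] M)) :
    IsBaseChange.linearMapRightBaseChangeHom S X (TensorProduct.mk R S M 1)
      ((LinearMap.lcomp R M f).lTensor S t) =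
    IsBaseChange.linearMapRightBaseChangeHom S Y (TensorProduct.mk R S M 1) t ∘ₗ f := by
  induction t with
  | zero => simp
  | add x y hx hy => rw [map_add, map_add, hx, hy, map_add, LinearMap.add_comp]
  | tmul s g => rfl

/-- Compare left exactness of Hom on a finite presentation of Z, before and after tensoring with S;
on finite free modules the map is bijective. -/
theorem linearMapRightBaseChangeHom_surjective [Module.Flat R S] (Z M : Type*) [AddCommGroup Z]
    [Module R Z] [AddCommGroup M] [Module R M] [Module.FinitePresentation R Z] :
    Function.Surjective
      (IsBaseChange.linearMapRightBaseChangeHom S Z (TensorProduct.mk R S M 1)) := by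
  obtain ⟨n, p, hp⟩ := Module.Finite.exists_fin' R Z
  have hfg : (LinearMap.ker p).FG := Module.FinitePresentation.fg_ker p hp
  have : Module.Finite R (LinearMap.ker p) := Module.Finite.iff_fg.2 hfg
  obtain ⟨m, q, hq⟩ := Module.Finite.exists_fin' R (LinearMap.ker p)
  obtain ⟨q', hq'⟩ : ∃ q' : (Fin m → R) →ₗ[R] (Fin n → R), q' = (LinearMap.ker p).subtype ∘ₗ q :=
    ⟨_, rfl⟩
  have hqp : Function.Exact q' p := by
    intro x
    subst hq'
    constructor
    · intro hx
      obtain ⟨y, hy⟩ := hq ⟨x, hx⟩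
      exact ⟨y, congrArg Subtype.val hy⟩
    · rintro ⟨y, rfl⟩
      exact (q y).2
  have hex : Function.Exact (LinearMap.lcomp R M p) (LinearMap.lcomp R M q') :=
    LinearMap.exact_lcomp_of_exact_of_surjective _ hqp hp
  have hexS := Module.Flat.lTensor_exact S hex
  intro h
  obtain ⟨v, hv⟩ := (IsBaseChange.linearMapRightBaseChangeEquiv (Fin n → R)
    (TensorProduct.isBaseChange R M S)).surjective (h ∘ₗ p)
  replace hv : IsBaseChange.linearMapRightBaseChangeHom S (Fin n → R) (TensorProduct.mk R S M 1) v =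
    h ∘ₗ p := hv
  have hv' : (LinearMap.lcomp R M q').lTensor S v = 0 := by
    apply (IsBaseChange.linearMapRightBaseChangeEquiv (Fin m → R)
      (TensorProduct.isBaseChange R M S)).injective
    rw [map_zero]
    refine (linearMapRightBaseChangeHom_lTensor_lcomp S q' v).trans ?_
    rw [hv, LinearMap.comp_assoc, hqp.linearMap_comp_eq_zero, LinearMap.comp_zero]
  obtain ⟨w, rfl⟩ := (hexS v).1 hv'
  refine ⟨w, ?_⟩
  have h1 := (linearMapRightBaseChangeHom_lTensor_lcomp S p w).symm.trans hv
  ext z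
  obtain ⟨x, rfl⟩ := hp z
  exact LinearMap.congr_fun h1 x

theorem exists_one_tmul_sub_mem {I : Ideal R}
    (hI : ∀ s : S, ∃ r : R, s - algebraMap R S r ∈ I.map (algebraMap R S))
    {X : Type*} [AddCommGroup X] [Module R X] (t : S ⊗[R] X) :
    ∃ x : X, t - 1 ⊗ₜ x ∈ I.map (algebraMap R S) • (⊤ : Submodule S (S ⊗[R] X)) := by
  induction t with
  | zero => exact ⟨0, by simp⟩
  | add a b ha hb =>
    obtain ⟨x, hx⟩ := ha
    obtain ⟨y, hy⟩ := hb
    refine ⟨x + y, ?_⟩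
    convert add_mem hx hy using 1
    rw [TensorProduct.tmul_add]
    abel
  | tmul s x =>
    obtain ⟨r, hr⟩ := hI s
    refine ⟨r • x, ?_⟩
    have : s ⊗ₜ[R] x - 1 ⊗ₜ[R] (r • x) = (s - algebraMap R S r) • ((1 : S) ⊗ₜ[R] x) := by
      rw [TensorProduct.smul_tmul', smul_eq_mul, mul_one, TensorProduct.sub_tmul,
        TensorProduct.tmul_smul, TensorProduct.smul_tmul', Algebra.algebraMap_eq_smul_one]
    rw [this]
    exact Submodule.smul_mem_smul hr trivial

/-- This is the surjectivity of Ext¹(B, M) → Ext¹(B, S ⊗ M) in terms of a presentation of B. Every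
element of S ⊗ Hom(Z, M) comes from R modulo I, and I times any map extends to G because I stably
annihilates B. -/
theorem exists_linearMap_add_extension [Module.Flat R S] {I : Ideal R}
    (hI : ∀ s : S, ∃ r : R, s - algebraMap R S r ∈ I.map (algebraMap R S))
    {Z G B M : Type*} [AddCommGroup Z] [Module R Z] [AddCommGroup G] [Module R G]
    [AddCommGroup B] [Module R B] [AddCommGroup M] [Module R M] [Module.FinitePresentation R Z]
    (hB : I ≤ stableAnnihilator R B) {i : Z →ₗ[R] G} {p : G →ₗ[R] B}
    (hi : Function.Injective i) (hip : Function.Exact i p) (hp : Function.Surjective p)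
    (h : Z →ₗ[R] S ⊗[R] M) :
    ∃ (g : Z →ₗ[R] M) (e : G →ₗ[R] S ⊗[R] M), ∀ z, h z = 1 ⊗ₜ g z + e (i z) := by
  let θ := IsBaseChange.linearMapRightBaseChangeHom S Z (TensorProduct.mk R S M 1)
  obtain ⟨t, rfl⟩ := linearMapRightBaseChangeHom_surjective S Z M h
  obtain ⟨g, hg⟩ := exists_one_tmul_sub_mem S hI t
  -- The maps that extend to G form an S-submodule, so only multipliers from I itself have to be
  -- checked.
  let E : Submodule S (Z →ₗ[R] S ⊗[R] M) :=
    { carrier := {f | ∃ e : G →ₗ[R] S ⊗[R] M, f = e ∘ₗ i}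
      zero_mem' := ⟨0, by simp⟩
      add_mem' := by
        rintro _ _ ⟨e, rfl⟩ ⟨e', rfl⟩
        exact ⟨e + e', by rw [LinearMap.add_comp]⟩
      smul_mem' := by
        rintro s _ ⟨e, rfl⟩
        exact ⟨s • e, by rw [LinearMap.smul_comp]⟩ }
  have hE : I.map (algebraMap R S) • (⊤ : Submodule S (S ⊗[R] (Z →ₗ[R] M))) ≤ E.comap θ := by
    rw [Submodule.smul_le]
    intro s hs f _
    have hle : I.map (algebraMap R S) ≤ E.comap (LinearMap.toSpanSingleton S _ (θ f)) := by
      rw [Ideal.map_le_iff_le_comap]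
      intro a ha
      obtain ⟨e, he⟩ := exists_extension_of_mem_stableAnnihilator (hB ha) hi hip hp
      refine ⟨θ f ∘ₗ e, ?_⟩
      rw [LinearMap.comp_assoc, he, LinearMap.toSpanSingleton_apply, algebraMap_smul]
      ext z
      simp
    rw [Submodule.mem_comap, map_smul]
    exact hle hs
  obtain ⟨e, he⟩ := hE hg
  refine ⟨g, e, fun z ↦ ?_⟩
  have := LinearMap.congr_fun he z
  rw [map_sub, LinearMap.sub_apply, sub_eq_iff_eq_add'] at this
  refine this.trans ?_
  congr 1
  simp [θ, IsBaseChange.linearMapRightBaseChangeHom]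

end HomBaseChange

theorem LinearMap.nonempty_linearEquiv_of_ker_eq {A X Y Z : Type*} [Ring A] [AddCommGroup X]
    [Module A X] [AddCommGroup Y] [Module A Y] [AddCommGroup Z] [Module A Z] {f : X →ₗ[A] Y}
    {g : X →ₗ[A] Z} (hf : Function.Surjective f) (hg : Function.Surjective g)
    (h : LinearMap.ker f = LinearMap.ker g) : Nonempty (Y ≃ₗ[A] Z) :=
  ⟨(f.quotKerEquivOfSurjective hf).symm ≪≫ₗ Submodule.quotEquivOfEq _ _ h ≪≫ₗ
    g.quotKerEquivOfSurjective hg⟩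

/-! ### Modules that descend, and their extensions. -/

section Descent

open scoped TensorProduct

variable (R S : Type u) [CommRing R] [IsLocalRing R] [CommRing S] [Algebra R S]

/-- `X` is the base change of a finitely generated `R`-module that is free on the punctured
spectrum, the latter condition being expressed by its stable annihilator. -/
def HasDescent (X : Type u) [AddCommGroup X] [Module S X] : Prop :=
  ∃ (M : Type u) (_ : AddCommGroup M) (_ : Module R M), Module.Finite R M ∧
    (∃ k, maximalIdeal R ^ k ≤ stableAnnihilator R M) ∧ Nonempty (S ⊗[R] M ≃ₗ[S] X)

variable {R S}

namespace HasDescent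

variable {X Y Z : Type u} [AddCommGroup X] [Module S X] [AddCommGroup Y] [Module S Y]
  [AddCommGroup Z] [Module S Z]

theorem congr (h : HasDescent R S X) (e : X ≃ₗ[S] Y) : HasDescent R S Y := by
  obtain ⟨M, i1, i2, hM, hk, ⟨e'⟩⟩ := h
  exact ⟨M, i1, i2, hM, hk, ⟨e' ≪≫ₗ e⟩⟩

theorem of_free [Module.Free S X] [Module.Finite S X] : HasDescent R S X := by
  rcases subsingleton_or_nontrivial S with _ | _
  · have : Subsingleton X := Module.subsingleton S X
    have : Subsingleton (S ⊗[R] (Fin 0 → R)) := Module.subsingleton S _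
    exact ⟨Fin 0 → R, inferInstance, inferInstance, inferInstance,
      ⟨0, le_top.trans_eq (stableAnnihilator_eq_top_of_free (A := R) (F := Fin 0 → R)).symm⟩,
      ⟨⟨0, 0, fun _ ↦ Subsingleton.elim _ _, fun _ ↦ Subsingleton.elim _ _⟩⟩⟩
  · exact ⟨Fin (Module.finrank S X) → R, inferInstance, inferInstance, inferInstance,
      ⟨0, le_top.trans_eq (stableAnnihilator_eq_top_of_free (A := R)
        (F := Fin (Module.finrank S X) → R)).symm⟩,
      ⟨TensorProduct.piScalarRight R S S (Fin (Module.finrank S X)) ≪≫ₗ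
        (Module.finBasis S X).equivFun.symm⟩⟩

/-- As R → S/m^k S is surjective, X itself, with scalars restricted to R, is the required module. -/
theorem of_pow_le_annihilator (k : ℕ)
    (hd : ∀ s : S, ∃ r : R, s - algebraMap R S r ∈ (maximalIdeal R ^ k).map (algebraMap R S))
    [Module.Finite S X] (h : (maximalIdeal R ^ k).map (algebraMap R S) ≤ Module.annihilator S X) :
    HasDescent R S X := by
  let _ : Module R X := Module.compHom X (algebraMap R S)
  have : IsScalarTower R S X := IsScalarTower.of_algebraMap_smul fun _ _ ↦ rfl
  have hsmul : ∀ s : S, ∃ r : R, ∀ x : X, s • x = r • x := fun s ↦ by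
    obtain ⟨r, hr⟩ := hd s
    refine ⟨r, fun x ↦ ?_⟩
    have := Module.mem_annihilator.1 (h hr) x
    rw [sub_smul, sub_eq_zero, algebraMap_smul] at this
    exact this
  refine ⟨X, inferInstance, inferInstance, ?_, ⟨k, ?_⟩, ?_⟩
  · obtain ⟨G, hG⟩ := (Module.Finite.fg_top : (⊤ : Submodule S X).FG)
    refine ⟨G, eq_top_iff.2 fun x _ ↦ ?_⟩
    have hx : x ∈ Submodule.span S (G : Set X) := hG ▸ trivial
    induction hx using Submodule.span_induction with
    | mem x hx => exact Submodule.subset_span hx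
    | zero => exact zero_mem _
    | add x y _ _ hx hy => exact add_mem (hx trivial) (hy trivial)
    | smul s x _ hx =>
      obtain ⟨r, hr⟩ := hsmul s
      rw [hr]
      exact Submodule.smul_mem _ _ (hx trivial)
  · refine le_trans (fun a ha ↦ Module.mem_annihilator.2 fun x ↦ ?_)
      annihilator_le_stableAnnihilator
    rw [← algebraMap_smul S a x]
    exact Module.mem_annihilator.1 (h (Ideal.mem_map_of_mem _ ha)) x
  · let φ : S ⊗[R] X →ₗ[S] X := (LinearMap.id : X →ₗ[R] X).liftBaseChange S
    have hφ : ∀ x, φ (1 ⊗ₜ x) = x := fun x ↦ by simp [φ]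
    have hone : ∀ t : S ⊗[R] X, ∃ x, t = 1 ⊗ₜ x := fun t ↦ by
      induction t with
      | zero => exact ⟨0, by simp⟩
      | add a b ha hb =>
        obtain ⟨x, rfl⟩ := ha
        obtain ⟨y, rfl⟩ := hb
        exact ⟨x + y, (TensorProduct.tmul_add _ _ _).symm⟩
      | tmul s x =>
        obtain ⟨r, hr⟩ := hd s
        refine ⟨r • x, ?_⟩
        rw [← sub_eq_zero, ← TensorProduct.smul_tmul, ← Algebra.algebraMap_eq_smul_one,
          ← TensorProduct.sub_tmul]
        have hle : (maximalIdeal R ^ k).map (algebraMap R S) ≤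
            LinearMap.ker (LinearMap.toSpanSingleton S (S ⊗[R] X) (1 ⊗ₜ x)) := by
          rw [Ideal.map_le_iff_le_comap]
          intro a ha
          have : a • x = 0 := by
            rw [← algebraMap_smul S a x]
            exact Module.mem_annihilator.1 (h (Ideal.mem_map_of_mem _ ha)) x
          simp [← TensorProduct.tmul_smul, this]
        simpa [TensorProduct.smul_tmul'] using hle hr
    refine ⟨LinearEquiv.ofBijective φ ⟨?_, fun x ↦ ⟨_, hφ x⟩⟩⟩
    rw [← LinearMap.ker_eq_bot, LinearMap.ker_eq_bot']
    intro t ht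
    obtain ⟨x, rfl⟩ := hone t
    rw [hφ] at ht
    rw [ht, TensorProduct.tmul_zero]

theorem of_exact [IsNoetherianRing R] [Module.Flat R S]
    (hd : ∀ (k : ℕ) (s : S), ∃ r : R,
      s - algebraMap R S r ∈ (maximalIdeal R ^ k).map (algebraMap R S))
    {f : X →ₗ[S] Y} {g : Y →ₗ[S] Z} (hf : Function.Injective f) (hfg : Function.Exact f g)
    (hg : Function.Surjective g) (hX : HasDescent R S X) (hZ : HasDescent R S Z) :
    HasDescent R S Y := by
  obtain ⟨M₁, _, _, _, ⟨k₁, hk₁⟩, ⟨e₁⟩⟩ := hX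
  obtain ⟨M₂, _, _, _, ⟨k₂, hk₂⟩, ⟨e₂⟩⟩ := hZ
  obtain ⟨n, p, hp⟩ := Module.Finite.exists_fin' R M₂
  let i := (LinearMap.ker p).subtype
  have hi : Function.Injective i := Subtype.val_injective
  have hip : Function.Exact i p := LinearMap.exact_subtype_ker_map p
  have hiS : Function.Exact (i.baseChange S) (p.baseChange S) := lTensor_exact S hip hp
  have hpS : Function.Surjective (p.baseChange S) := LinearMap.lTensor_surjective S hp
  obtain ⟨φ₀, hφ₀⟩ := Module.projective_lifting_property g
    (e₂.toLinearMap ∘ₗ p.baseChange S) hg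
  have hφ₀' : ∀ t, g (φ₀ t) = e₂ (p.baseChange S t) := LinearMap.congr_fun hφ₀
  have hmem : ∀ t, φ₀ (i.baseChange S t) ∈ LinearMap.range f := fun t ↦ (hfg _).1 <| by
    rw [hφ₀', hiS.apply_apply_eq_zero, map_zero]
  let η : S ⊗[R] LinearMap.ker p →ₗ[S] X := (LinearEquiv.ofInjective f hf).symm.toLinearMap ∘ₗ
    LinearMap.codRestrict (LinearMap.range f) (φ₀ ∘ₗ i.baseChange S) hmem
  have hη : ∀ t, f (η t) = φ₀ (i.baseChange S t) := fun t ↦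
    congrArg Subtype.val ((LinearEquiv.ofInjective f hf).apply_symm_apply ⟨_, hmem t⟩)
  have := Module.finitePresentation_of_finite R (LinearMap.ker p)
  -- The map η represents the class of the extension. It is a map γ defined over R plus one that
  -- extends to the free cover, so γ represents the same class.
  obtain ⟨γ, ε, hγ⟩ := exists_linearMap_add_extension S (hd k₂) hk₂ hi hip hp
    ((e₁.symm.toLinearMap ∘ₗ η).restrictScalars R ∘ₗ TensorProduct.mk R S _ 1)
  -- Removing the extendable part keeps the composite with g and makes φ restrict to γ on the
  -- syzygy.
  let φ : S ⊗[R] (Fin n → R) →ₗ[S] Y := φ₀ - f ∘ₗ e₁.toLinearMap ∘ₗ ε.liftBaseChange S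
  have hφg : ∀ t, g (φ t) = e₂ (p.baseChange S t) := fun t ↦ by
    simp only [φ, LinearMap.sub_apply, map_sub, LinearMap.comp_apply, hφ₀',
      hfg.apply_apply_eq_zero, sub_zero]
  have hφi : ∀ z, φ (1 ⊗ₜ i z) = f (e₁ (1 ⊗ₜ γ z)) := fun z ↦ by
    have h1 : e₁.symm (η (1 ⊗ₜ z)) = 1 ⊗ₜ γ z + ε (i z) := hγ z
    have h2 := hη (1 ⊗ₜ z)
    rw [(LinearEquiv.symm_apply_eq _).1 h1, LinearMap.baseChange_tmul] at h2
    simp only [φ, LinearMap.sub_apply, ← h2]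
    simp
  -- The cokernel of j is the pushout of i along γ, that is, the extension of M₂ by M₁ with class γ;
  -- Ψ identifies its base change with Y.
  let j : LinearMap.ker p →ₗ[R] M₁ × (Fin n → R) := (-γ).prod i
  let M := (M₁ × (Fin n → R)) ⧸ LinearMap.range j
  let fst := LinearMap.fst R M₁ (Fin n → R)
  let snd := LinearMap.snd R M₁ (Fin n → R)
  let inl := LinearMap.inl R M₁ (Fin n → R)
  let inr := LinearMap.inr R M₁ (Fin n → R)
  let Ψ : S ⊗[R] (M₁ × (Fin n → R)) →ₗ[S] Y :=
    f ∘ₗ e₁.toLinearMap ∘ₗ fst.baseChange S + φ ∘ₗ snd.baseChange S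
  have hΨ : ∀ t, Ψ t = f (e₁ (fst.baseChange S t)) + φ (snd.baseChange S t) := fun t ↦ rfl
  have hdec : ∀ t, t = inl.baseChange S (fst.baseChange S t) +
      inr.baseChange S (snd.baseChange S t) := fun t ↦ by
    have : (LinearMap.id : _ →ₗ[S] S ⊗[R] (M₁ × (Fin n → R))) =
        (inl ∘ₗ fst + inr ∘ₗ snd).baseChange S := by
      have : inl ∘ₗ fst + inr ∘ₗ snd = LinearMap.id := by ext <;> simp [inl, fst, inr, snd]
      rw [this, LinearMap.baseChange_id]
    have := LinearMap.congr_fun this t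
    rw [LinearMap.baseChange_add, LinearMap.baseChange_comp, LinearMap.baseChange_comp] at this
    exact this
  have hcomp {A B C : Type u} [AddCommGroup A] [Module R A] [AddCommGroup B] [Module R B]
      [AddCommGroup C] [Module R C] (u : B →ₗ[R] C) (v : A →ₗ[R] B) (w : A →ₗ[R] C)
      (h : u ∘ₗ v = w) (t) : u.baseChange S (v.baseChange S t) = w.baseChange S t := by
    rw [← h, LinearMap.baseChange_comp, LinearMap.comp_apply]
  have hΨsurj : Function.Surjective Ψ := fun y ↦ by
    obtain ⟨t, ht⟩ := hpS (e₂.symm (g y))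
    have : g (y - φ t) = 0 := by rw [map_sub, hφg, ht, LinearEquiv.apply_symm_apply, sub_self]
    obtain ⟨x, hx⟩ := (hfg _).1 this
    refine ⟨inl.baseChange S (e₁.symm x) + inr.baseChange S t, ?_⟩
    rw [hΨ, map_add (fst.baseChange S), map_add (snd.baseChange S),
      hcomp fst inl LinearMap.id rfl, hcomp fst inr 0 rfl,
      hcomp snd inl 0 rfl, hcomp snd inr LinearMap.id rfl]
    simp [hx]
  have hΨj : ∀ t, Ψ (j.baseChange S t) = 0 := fun t ↦ by
    induction t with
    | zero => simp
    | add a b ha hb => simp [ha, hb]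
    | tmul s z =>
      have : s ⊗ₜ[R] z = s • ((1 : S) ⊗ₜ[R] z) := by simp [TensorProduct.smul_tmul']
      rw [this, map_smul, map_smul, hΨ, hcomp fst j (-γ) rfl, hcomp snd j i rfl,
        LinearMap.baseChange_tmul, LinearMap.baseChange_tmul, hφi]
      simp [TensorProduct.tmul_neg]
  have hker : LinearMap.ker ((LinearMap.range j).mkQ.baseChange S) = LinearMap.ker Ψ := by
    have hj : Function.Exact (j.baseChange S) ((LinearMap.range j).mkQ.baseChange S) :=
      lTensor_exact S (LinearMap.exact_map_mkQ_range j) (Submodule.mkQ_surjective _)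
    ext t
    rw [LinearMap.mem_ker, LinearMap.mem_ker]
    constructor
    · intro ht
      obtain ⟨z, rfl⟩ := (hj t).1 ht
      exact hΨj z
    · intro ht
      have h1 : p.baseChange S (snd.baseChange S t) = 0 := by
        apply e₂.injective
        rw [map_zero, ← hφg, ← map_zero g, ← ht, hΨ, map_add, hfg.apply_apply_eq_zero, zero_add]
      obtain ⟨z, hz⟩ := (hiS _).1 h1
      have h2 : snd.baseChange S (t - j.baseChange S z) = 0 := by
        rw [map_sub, hcomp snd j i rfl, hz, sub_self]
      have h3 : fst.baseChange S (t - j.baseChange S z) = 0 := by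
        apply e₁.injective
        apply hf
        have : Ψ (t - j.baseChange S z) = 0 := by rw [map_sub, ht, hΨj, sub_zero]
        rw [hΨ, h2, map_zero, add_zero] at this
        rw [this, map_zero, map_zero]
      have h4 := hdec (t - j.baseChange S z)
      rw [h2, h3, map_zero, map_zero, add_zero, sub_eq_zero] at h4
      exact (hj t).2 ⟨z, h4.symm⟩
  refine ⟨M, inferInstance, inferInstance, inferInstance, ⟨k₁ + k₂, ?_⟩,
    LinearMap.nonempty_linearEquiv_of_ker_eq
      (LinearMap.lTensor_surjective S (Submodule.mkQ_surjective _)) hΨsurj hker⟩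
  let a : M₁ →ₗ[R] M := (LinearMap.range j).mkQ ∘ₗ inl
  let b : M →ₗ[R] M₂ := (LinearMap.range j).liftQ (p ∘ₗ snd) (by
    rintro _ ⟨z, rfl⟩
    exact z.2)
  have ha : Function.Injective a := by
    rw [← LinearMap.ker_eq_bot, LinearMap.ker_eq_bot']
    intro m hm
    obtain ⟨z, hz⟩ := (Submodule.Quotient.mk_eq_zero _).1 hm
    have h2 : (z : Fin n → R) = 0 := congrArg Prod.snd hz
    have h1 : -γ z = m := congrArg Prod.fst hz
    have hz0 : z = 0 := Subtype.ext h2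
    rw [← h1, hz0, map_zero, neg_zero]
  have hb : Function.Surjective b := fun y ↦ by
    obtain ⟨x, rfl⟩ := hp y
    exact ⟨(LinearMap.range j).mkQ (0, x), rfl⟩
  have hab : Function.Exact a b := fun y ↦ by
    obtain ⟨⟨m, x⟩, rfl⟩ := Submodule.mkQ_surjective _ y
    constructor
    · intro hx
      have hx' : p x = 0 := hx
      refine ⟨m + γ ⟨x, hx'⟩, ?_⟩
      refine (Submodule.Quotient.eq _).2 ⟨-⟨x, hx'⟩, ?_⟩
      ext <;> simp [j, i, inl]
    · rintro ⟨m', hm'⟩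
      rw [← hm']
      exact map_zero p
  rw [pow_add]
  exact (Ideal.mul_mono hk₁ hk₂).trans (stableAnnihilator_mul_le_of_exact ha hab hb)

end HasDescent

end Descent

/-! ### Kernels of maps out of products, and Schanuel's lemma. -/

section Schanuel

variable {A T U V : Type*} [Ring A] [AddCommGroup T] [Module A T] [AddCommGroup U]
  [Module A U] [AddCommGroup V] [Module A V]

/-- If `β` factors through `α`, the kernel of `(α, β)` is the product of the kernel of `α` and the
source of `β`. -/
def LinearMap.kerCoprodEquivOfFactor (α : U →ₗ[A] T) (β : V →ₗ[A] T) (σ : V →ₗ[A] U)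
    (h : α ∘ₗ σ = β) : LinearMap.ker (α.coprod β) ≃ₗ[A] LinearMap.ker α × V where
  toFun t := (⟨t.1.1 + σ t.1.2, by
    have h1 : α t.1.1 + β t.1.2 = 0 := t.2
    rw [LinearMap.mem_ker, map_add, ← LinearMap.comp_apply, h, h1]⟩, t.1.2)
  invFun y := ⟨(y.1.1 - σ y.2, y.2), by
    have h1 : α y.1.1 = 0 := y.1.2
    rw [LinearMap.mem_ker, LinearMap.coprod_apply, map_sub, ← LinearMap.comp_apply, h, h1]
    simp⟩
  map_add' s t := by
    ext
    · simp only [Submodule.coe_add, Prod.fst_add, Prod.snd_add, map_add]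
      abel
    · rfl
  map_smul' a t := by
    ext
    · simp
    · rfl
  left_inv t := by
    ext <;> simp
  right_inv y := by
    ext <;> simp

/-- Swapping the two sources of a map out of a product. -/
def LinearMap.kerCoprodSwap (α : U →ₗ[A] T) (β : V →ₗ[A] T) :
    LinearMap.ker (α.coprod β) ≃ₗ[A] LinearMap.ker (β.coprod α) where
  toFun t := ⟨t.1.swap, by
    have h1 : α t.1.1 + β t.1.2 = 0 := t.2
    simpa [add_comm] using h1⟩
  invFun t := ⟨t.1.swap, by
    have h1 : β t.1.1 + α t.1.2 = 0 := t.2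
    simpa [add_comm] using h1⟩
  map_add' _ _ := rfl
  map_smul' _ _ := rfl
  left_inv _ := rfl
  right_inv _ := rfl

/-- The kernel of a product map is the product of the kernels. -/
def LinearMap.kerProdMapEquiv {T' : Type*} [AddCommGroup T'] [Module A T'] (α : U →ₗ[A] T)
    (β : V →ₗ[A] T') :
    LinearMap.ker (α.prodMap β) ≃ₗ[A] LinearMap.ker α × LinearMap.ker β where
  toFun t := (⟨t.1.1, congrArg Prod.fst t.2⟩, ⟨t.1.2, congrArg Prod.snd t.2⟩)
  invFun y := ⟨(y.1.1, y.2.1), Prod.ext y.1.2 y.2.2⟩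
  map_add' _ _ := rfl
  map_smul' _ _ := rfl
  left_inv _ := rfl
  right_inv _ := rfl

/-- The source of an injective map `f` exact with `g` is the kernel of `g`. -/
noncomputable def Function.Exact.kerEquiv {f : U →ₗ[A] V} {g : V →ₗ[A] T}
    (h : Function.Exact f g) (hf : Function.Injective f) : U ≃ₗ[A] LinearMap.ker g :=
  LinearEquiv.ofInjective f hf ≪≫ₗ LinearEquiv.ofEq _ _ h.linearMap_ker_eq.symm

/-- Schanuel's lemma. -/
theorem LinearMap.nonempty_ker_prod_equiv [Module.Projective A U] [Module.Projective A V]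
    {α : U →ₗ[A] T} {β : V →ₗ[A] T} (hα : Function.Surjective α) (hβ : Function.Surjective β) :
    Nonempty ((LinearMap.ker α × V) ≃ₗ[A] (LinearMap.ker β × U)) := by
  obtain ⟨σ, hσ⟩ := Module.projective_lifting_property α β hα
  obtain ⟨τ, hτ⟩ := Module.projective_lifting_property β α hβ
  exact ⟨(LinearMap.kerCoprodEquivOfFactor α β σ hσ).symm ≪≫ₗ LinearMap.kerCoprodSwap α β ≪≫ₗ
    LinearMap.kerCoprodEquivOfFactor β α τ hτ⟩

theorem Function.Exact.prodMap_linearMap {U' V' T' : Type*} [AddCommGroup U'] [Module A U']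
    [AddCommGroup V'] [Module A V'] [AddCommGroup T'] [Module A T'] {f : U →ₗ[A] V}
    {g : V →ₗ[A] T} {f' : U' →ₗ[A] V'} {g' : V' →ₗ[A] T'} (h : Function.Exact f g)
    (h' : Function.Exact f' g') : Function.Exact (f.prodMap f') (g.prodMap g') := by
  rintro ⟨y, y'⟩
  constructor
  · intro hy
    obtain ⟨x, rfl⟩ := (h y).1 (congrArg Prod.fst hy)
    obtain ⟨x', rfl⟩ := (h' y').1 (congrArg Prod.snd hy)
    exact ⟨(x, x'), rfl⟩
  · rintro ⟨⟨x, x'⟩, hx⟩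
    rw [← hx]
    exact Prod.ext (h.apply_apply_eq_zero x) (h'.apply_apply_eq_zero x')

end Schanuel

/-! ### Twisting a class of modules by ring elements. -/

section Twist

variable {S : Type u} [CommRing S]

/-- A class of finite modules containing the finite free ones, and closed under finite products and
kernels of surjections. -/
structure IsKernelClosed (D : ∀ (X : Type u) [AddCommGroup X] [Module S X], Prop) : Prop where
  finite : ∀ {X : Type u} [AddCommGroup X] [Module S X], D X → Module.Finite S X
  free : ∀ {F : Type u} [AddCommGroup F] [Module S F] [Module.Free S F] [Module.Finite S F], D F
  prod : ∀ {X Y : Type u} [AddCommGroup X] [Module S X] [AddCommGroup Y] [Module S Y],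
    D X → D Y → D (X × Y)
  ker : ∀ {X Y : Type u} [AddCommGroup X] [Module S X] [AddCommGroup Y] [Module S Y]
    {f : X →ₗ[S] Y}, Function.Surjective f → D X → D Y → D (LinearMap.ker f)

/-- A class of modules containing the finite free ones, closed under extensions, syzygies, and
cancellation of the members of `D`. -/
structure IsSyzygyClosed (D P : ∀ (X : Type u) [AddCommGroup X] [Module S X], Prop) : Prop where
  free : ∀ {F : Type u} [AddCommGroup F] [Module S F] [Module.Free S F] [Module.Finite S F], P F
  extension : ∀ {X Y Z : Type u} [AddCommGroup X] [Module S X] [AddCommGroup Y] [Module S Y]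
    [AddCommGroup Z] [Module S Z] {f : X →ₗ[S] Y} {g : Y →ₗ[S] Z}, Function.Injective f →
    Function.Exact f g → Function.Surjective g → P X → P Z → P Y
  syzygy : ∀ {Z F B : Type u} [AddCommGroup Z] [Module S Z] [AddCommGroup F] [Module S F]
    [AddCommGroup B] [Module S B] [Module.Free S F] [Module.Finite S F] {f : Z →ₗ[S] F}
    {g : F →ₗ[S] B}, Function.Injective f → Function.Exact f g → Function.Surjective g →
    P B → P Z
  cancel : ∀ {X Y : Type u} [AddCommGroup X] [Module S X] [AddCommGroup Y] [Module S Y],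
    D Y → P (X × Y) → P X

/-- The twist of a class `P` by `x`: the modules `T` for which the kernel of `(π, x) : F × T → T`
lies in `P`, where `π : F → T` is a finite free cover. -/
def Twist (x : S) (P : ∀ (X : Type u) [AddCommGroup X] [Module S X], Prop) (T : Type u)
    [AddCommGroup T] [Module S T] : Prop :=
  ∃ (m : ℕ) (π : (Fin m → S) →ₗ[S] T), Function.Surjective π ∧
    P (LinearMap.ker (π.coprod (x • LinearMap.id)))

variable {D P : ∀ (X : Type u) [AddCommGroup X] [Module S X], Prop}

namespace IsSyzygyClosed

variable {X Y Z T : Type u} [AddCommGroup X] [Module S X] [AddCommGroup Y] [Module S Y]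
  [AddCommGroup Z] [Module S Z] [AddCommGroup T] [Module S T]

/-- An isomorphism is an extension by the zero module, which is free. -/
theorem congr (hP : IsSyzygyClosed D P) (e : X ≃ₗ[S] Y) (h : P X) : P Y :=
  hP.extension (f := e.toLinearMap) (g := (0 : Y →ₗ[S] PUnit.{u + 1})) e.injective
    (fun y ↦ ⟨fun _ ↦ ⟨e.symm y, e.apply_symm_apply y⟩, fun _ ↦ rfl⟩)
    (fun _ ↦ ⟨0, rfl⟩) h hP.free

theorem prod (hP : IsSyzygyClosed D P) (hX : P X) (hY : P Y) : P (X × Y) :=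
  hP.extension (f := LinearMap.inl S X Y) (g := LinearMap.snd S X Y) LinearMap.inl_injective
    Function.Exact.inl_snd LinearMap.snd_surjective hX hY

/-- Independence of the cover. The kernel of (π, x, ρ) is each of the two kernels plus a free
module, as in Schanuel's lemma, and the free summand is cancelled. -/
theorem ker_of_twist (hD : IsKernelClosed D) (hP : IsSyzygyClosed D P) {x : S}
    (h : Twist x P T) {F : Type u} [AddCommGroup F] [Module S F] [Module.Free S F]
    [Module.Finite S F] {ρ : F →ₗ[S] T} (hρ : Function.Surjective ρ) :
    P (LinearMap.ker (ρ.coprod (x • LinearMap.id))) := by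
  obtain ⟨m, π, hπ, h⟩ := h
  obtain ⟨σ, hσ⟩ := Module.projective_lifting_property π ρ hπ
  obtain ⟨τ, hτ⟩ := Module.projective_lifting_property ρ π hρ
  let α := π.coprod (x • LinearMap.id)
  let β := ρ.coprod (x • LinearMap.id)
  have e₁ := LinearMap.kerCoprodEquivOfFactor α ρ (LinearMap.inl S _ _ ∘ₗ σ) (by
    rw [← LinearMap.comp_assoc, LinearMap.coprod_inl, hσ])
  have e₂ := LinearMap.kerCoprodEquivOfFactor β π (LinearMap.inl S _ _ ∘ₗ τ) (by
    rw [← LinearMap.comp_assoc, LinearMap.coprod_inl, hτ])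
  have e₃ : LinearMap.ker (α.coprod ρ) ≃ₗ[S] LinearMap.ker (β.coprod π) :=
    { toFun := fun t ↦ ⟨((t.1.2, t.1.1.2), t.1.1.1), by
        have h1 : π t.1.1.1 + x • t.1.1.2 + ρ t.1.2 = 0 := t.2
        change ρ t.1.2 + x • t.1.1.2 + π t.1.1.1 = 0
        rw [← h1]; abel⟩
      invFun := fun t ↦ ⟨((t.1.2, t.1.1.2), t.1.1.1), by
        have h1 : ρ t.1.1.1 + x • t.1.1.2 + π t.1.2 = 0 := t.2
        change π t.1.2 + x • t.1.1.2 + ρ t.1.1.1 = 0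
        rw [← h1]; abel⟩
      map_add' := fun _ _ ↦ rfl
      map_smul' := fun _ _ ↦ rfl
      left_inv := fun _ ↦ rfl
      right_inv := fun _ ↦ rfl }
  exact hP.cancel (Y := Fin m → S) hD.free
    (hP.congr (e₁.symm ≪≫ₗ e₃ ≪≫ₗ e₂) (hP.prod h hP.free))

theorem twist_of_ker (hP : IsSyzygyClosed D P) {x : S}
    {F : Type u} [AddCommGroup F] [Module S F] [Module.Free S F]
    [Module.Finite S F] {ρ : F →ₗ[S] T} (hρ : Function.Surjective ρ)
    (h : P (LinearMap.ker (ρ.coprod (x • LinearMap.id)))) : Twist x P T := by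
  rcases subsingleton_or_nontrivial S with _ | _
  · have : Subsingleton T := Module.subsingleton S T
    have := Module.subsingleton S
    have : Subsingleton (LinearMap.ker ((0 : (Fin 0 → S) →ₗ[S] T).coprod (x • LinearMap.id))) :=
      this _
    exact ⟨0, 0, fun _ ↦ ⟨0, Subsingleton.elim _ _⟩, hP.free⟩
  · let e := (Module.finBasis S F).equivFun
    refine ⟨_, ρ ∘ₗ e.symm.toLinearMap, hρ.comp e.symm.surjective, hP.congr ?_ h⟩
    exact
      { toFun := fun t ↦ ⟨(e t.1.1, t.1.2), by
          have h1 : ρ t.1.1 + x • t.1.2 = 0 := t.2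
          change ρ (e.symm (e t.1.1)) + x • t.1.2 = 0
          rw [e.symm_apply_apply, h1]⟩
        invFun := fun t ↦ ⟨(e.symm t.1.1, t.1.2), t.2⟩
        map_add' := fun s t ↦ by ext <;> simp
        map_smul' := fun a t ↦ by ext <;> simp
        left_inv := fun t ↦ by ext <;> simp
        right_inv := fun t ↦ by ext <;> simp }

/-- The exact sequence of twisted modules attached to an exact sequence and covers of its ends. -/
theorem exists_exact_ker_coprod {f : X →ₗ[S] Y} {g : Y →ₗ[S] Z} (hf : Function.Injective f)
    (hfg : Function.Exact f g) (hg : Function.Surjective g) (x : S) {F G : Type u}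
    [AddCommGroup F] [Module S F] [AddCommGroup G] [Module S G] {π : F →ₗ[S] X}
    (hπ : Function.Surjective π) (ρ : G →ₗ[S] Y) :
    ∃ (i : LinearMap.ker (π.coprod (x • LinearMap.id)) →ₗ[S]
        LinearMap.ker (((f ∘ₗ π).coprod ρ).coprod (x • LinearMap.id)))
      (p : LinearMap.ker (((f ∘ₗ π).coprod ρ).coprod (x • LinearMap.id)) →ₗ[S]
        LinearMap.ker ((g ∘ₗ ρ).coprod (x • LinearMap.id))),
      Function.Injective i ∧ Function.Exact i p ∧ Function.Surjective p := by
  have key (b : G) (y : Y) (h : g (ρ b) + x • g y = 0) : ∃ a, f (π a) + ρ b + x • y = 0 := by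
    obtain ⟨w, hw⟩ := (hfg (ρ b + x • y)).1 (by rw [map_add, map_smul, h])
    obtain ⟨a, rfl⟩ := hπ w
    refine ⟨-a, ?_⟩
    rw [map_neg, map_neg, hw]
    abel
  let i := LinearMap.codRestrict (LinearMap.ker (((f ∘ₗ π).coprod ρ).coprod (x • LinearMap.id)))
    ((LinearMap.inl S F G).prodMap f ∘ₗ
      (LinearMap.ker (π.coprod (x • LinearMap.id))).subtype) fun t ↦ by
      have h1 : π t.1.1 + x • t.1.2 = 0 := t.2
      change f (π t.1.1) + ρ 0 + x • f t.1.2 = 0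
      rw [map_zero, add_zero, ← map_smul, ← map_add, h1, map_zero]
  let p := LinearMap.codRestrict (LinearMap.ker ((g ∘ₗ ρ).coprod (x • LinearMap.id)))
    ((LinearMap.snd S F G).prodMap g ∘ₗ
      (LinearMap.ker (((f ∘ₗ π).coprod ρ).coprod (x • LinearMap.id))).subtype) fun t ↦ by
      have h1 : f (π t.1.1.1) + ρ t.1.1.2 + x • t.1.2 = 0 := t.2
      have h2 := congrArg g h1
      change g (ρ t.1.1.2) + x • g t.1.2 = 0
      rwa [map_add, map_add, hfg.apply_apply_eq_zero, zero_add, map_smul, map_zero] at h2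
  have hi (t) : (i t).1 = ((t.1.1, 0), f t.1.2) := rfl
  have hp (t) : (p t).1 = (t.1.1.2, g t.1.2) := rfl
  clear_value i p
  refine ⟨i, p, ?_, ?_, ?_⟩
  · intro s t h
    have h' := congrArg Subtype.val h
    rw [hi, hi, Prod.mk.injEq, Prod.mk.injEq] at h'
    exact Subtype.ext (Prod.ext h'.1.1 (hf h'.2))
  · intro t
    constructor
    · intro h
      have h' := congrArg Subtype.val h
      rw [hp] at h'
      have hb : t.1.1.2 = 0 := congrArg Prod.fst h'
      have hgy : g t.1.2 = 0 := congrArg Prod.snd h'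
      obtain ⟨z, hz⟩ := (hfg _).1 hgy
      have ht : f (π t.1.1.1) + ρ t.1.1.2 + x • t.1.2 = 0 := t.2
      have hz' : π t.1.1.1 + x • z = 0 := hf <| by
        rw [map_add, map_smul, map_zero, hz, ← ht, hb, map_zero, add_zero]
      refine ⟨⟨(t.1.1.1, z), hz'⟩, Subtype.ext ?_⟩
      rw [hi, hz, ← hb]
    · rintro ⟨t, rfl⟩
      apply Subtype.ext
      rw [hp, hi, hfg.apply_apply_eq_zero]
      rfl
  · intro t
    have ht : g (ρ t.1.1) + x • t.1.2 = 0 := t.2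
    obtain ⟨y, hy⟩ := hg t.1.2
    rw [← hy] at ht
    obtain ⟨a, ha⟩ := key _ _ ht
    refine ⟨⟨((a, t.1.1), y), ha⟩, Subtype.ext ?_⟩
    rw [hp, hy]

theorem coprod_surjective {f : X →ₗ[S] Y} {g : Y →ₗ[S] Z}
    (hfg : Function.Exact f g) {F G : Type u}
    [AddCommGroup F] [Module S F] [AddCommGroup G] [Module S G] {π : F →ₗ[S] X}
    (hπ : Function.Surjective π) {ρ : G →ₗ[S] Y} (hρ : Function.Surjective (g ∘ₗ ρ)) :
    Function.Surjective ((f ∘ₗ π).coprod ρ) := fun y ↦ by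
  obtain ⟨b, hb⟩ := hρ (g y)
  have hb' : g (ρ b) = g y := hb
  obtain ⟨w, hw⟩ := (hfg (y - ρ b)).1 (by rw [map_sub, hb', sub_self])
  obtain ⟨a, rfl⟩ := hπ w
  exact ⟨(a, b), by simp [hw]⟩

theorem twist [IsNoetherianRing S] (hD : IsKernelClosed D) (hP : IsSyzygyClosed D P) (x : S) :
    IsSyzygyClosed D (Twist x P) where
  free {F} _ _ _ _ := by
    refine hP.twist_of_ker (ρ := (LinearMap.id : F →ₗ[S] F)) Function.surjective_id ?_
    exact hP.congr (LinearMap.kerCoprodEquivOfFactor LinearMap.id (x • LinearMap.id)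
      (x • LinearMap.id) rfl).symm (hP.prod
        (hP.congr (LinearEquiv.ofEq _ _ LinearMap.ker_id.symm) hP.free) hP.free)
  extension {X Y Z} _ _ _ _ _ _ f g hf hfg hg hX hZ := by
    obtain ⟨m, π, hπ, hX⟩ := hX
    obtain ⟨k, ρ', hρ', -⟩ := id hZ
    obtain ⟨ρ, rfl⟩ := Module.projective_lifting_property g ρ' hg
    obtain ⟨i, p, hi, hip, hp⟩ := exists_exact_ker_coprod hf hfg hg x hπ ρ
    exact hP.twist_of_ker (coprod_surjective hfg hπ hρ')
      (hP.extension hi hip hp hX (hP.ker_of_twist hD hZ hρ'))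
  syzygy {Z F B} _ _ _ _ _ _ _ _ f g hf hfg hg hB := by
    have : Module.Finite S Z := Module.Finite.of_injective f hf
    obtain ⟨m, π, hπ⟩ := Module.Finite.exists_fin' S Z
    -- With F covered by the identity, the covering coordinate in F is determined by the others. The
    -- middle kernel is thus free, and the kernel for Z is a syzygy of the one for B.
    obtain ⟨i, p, hi, hip, hp⟩ := exists_exact_ker_coprod hf hfg hg x hπ LinearMap.id
    let e : LinearMap.ker (((f ∘ₗ π).coprod LinearMap.id).coprod (x • LinearMap.id)) ≃ₗ[S]
        ((Fin m → S) × F) :=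
      { toFun := fun t ↦ (t.1.1.1, t.1.2)
        invFun := fun t ↦ ⟨((t.1, -(f (π t.1) + x • t.2)), t.2), by
          change f (π t.1) + -(f (π t.1) + x • t.2) + x • t.2 = 0
          abel⟩
        map_add' := fun _ _ ↦ rfl
        map_smul' := fun _ _ ↦ rfl
        left_inv := fun t ↦ by
          have h1 : f (π t.1.1.1) + t.1.1.2 + x • t.1.2 = 0 := t.2
          refine Subtype.ext (Prod.ext (Prod.ext rfl ?_) rfl)
          change -(f (π t.1.1.1) + x • t.1.2) = t.1.1.2
          rw [neg_eq_iff_add_eq_zero, ← h1]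
          abel
        right_inv := fun _ ↦ rfl }
    have := Module.Free.of_equiv e.symm
    have := Module.Finite.equiv e.symm
    exact ⟨m, π, hπ, hP.syzygy hi hip hp (hP.ker_of_twist hD hB (ρ := g ∘ₗ LinearMap.id) hg)⟩
  cancel {X Y} _ _ _ _ hY h := by
    obtain ⟨_, q, hq, -⟩ := id h
    have := Module.Finite.of_surjective q hq
    have : Module.Finite S X :=
      Module.Finite.of_surjective (LinearMap.fst S X Y) LinearMap.fst_surjective
    have := hD.finite hY
    obtain ⟨m, π, hπ⟩ := Module.Finite.exists_fin' S X
    obtain ⟨k, ρ, hρ⟩ := Module.Finite.exists_fin' S Y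
    have h1 := hP.ker_of_twist hD h (ρ := π.prodMap ρ) (hπ.prodMap hρ)
    let e : LinearMap.ker ((π.prodMap ρ).coprod (x • LinearMap.id)) ≃ₗ[S]
        LinearMap.ker (π.coprod (x • LinearMap.id)) ×
          LinearMap.ker (ρ.coprod (x • LinearMap.id)) :=
      { toFun := fun t ↦ (⟨(t.1.1.1, t.1.2.1), congrArg Prod.fst t.2⟩,
          ⟨(t.1.1.2, t.1.2.2), congrArg Prod.snd t.2⟩)
        invFun := fun y ↦ ⟨((y.1.1.1, y.2.1.1), (y.1.1.2, y.2.1.2)), Prod.ext y.1.2 y.2.2⟩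
        map_add' := fun _ _ ↦ rfl
        map_smul' := fun _ _ ↦ rfl
        left_inv := fun _ ↦ rfl
        right_inv := fun _ ↦ rfl }
    -- The factor belonging to Y is the kernel of a surjection from a free module times Y onto Y,
    -- hence lies in D.
    refine ⟨m, π, hπ, hP.cancel (hD.ker ?_ (hD.prod hD.free hY) hY) (hP.congr e h1)⟩
    exact fun y ↦ let ⟨b, hb⟩ := hρ y; ⟨(b, 0), by simp [hb]⟩

end IsSyzygyClosed

/-- The iterated twist of a class of modules by a list of elements. -/
def IteratedTwist (P : ∀ (X : Type u) [AddCommGroup X] [Module S X], Prop) (xs : List S)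
    (T : Type u) [AddCommGroup T] [Module S T] : Prop :=
  match xs with
  | [] => P T
  | x :: xs => Twist x (IteratedTwist P xs) T

theorem IsSyzygyClosed.iteratedTwist [IsNoetherianRing S] (hD : IsKernelClosed D)
    (hP : IsSyzygyClosed D P) (xs : List S) : IsSyzygyClosed D (IteratedTwist P xs) := by
  induction xs with
  | nil => exact hP
  | cons x xs ih => exact ih.twist hD x

/-- The kernel and cokernel of x on T are killed by x and by the annihilator of T, so x moves from
the list into the annihilator. The twisted kernel of T is built from the kernel of x and a syzygy of
its cokernel. Once the list is empty, I kills the module. -/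
theorem IsSyzygyClosed.iteratedTwist_of_le [IsNoetherianRing S] (hD : IsKernelClosed D)
    (hP : IsSyzygyClosed D P) {I : Ideal S}
    (hI : ∀ (X : Type u) [AddCommGroup X] [Module S X] [Module.Finite S X],
      I ≤ Module.annihilator S X → P X) (xs : List S) (T : Type u) [AddCommGroup T] [Module S T]
    [Module.Finite S T] (h : I ≤ Module.annihilator S T ⊔ Ideal.ofList xs) :
    IteratedTwist P xs T := by
  induction xs generalizing T with
  | nil => exact hI T (by simpa using h)
  | cons x xs ih =>
    have hQ := hP.iteratedTwist hD xs
    let c : T →ₗ[S] T := x • LinearMap.id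
    have hc (t : T) : c t = x • t := rfl
    rw [Ideal.ofList_cons, ← sup_assoc] at h
    have h1 : IteratedTwist P xs (LinearMap.ker c) := by
      refine ih _ (h.trans (sup_le_sup_right (sup_le ?_ ?_) _))
      · exact fun a ha ↦ Module.mem_annihilator.2 fun t ↦
          Subtype.ext (Module.mem_annihilator.1 ha t.1)
      · rw [Ideal.span_singleton_le_iff_mem, Module.mem_annihilator]
        exact fun t ↦ Subtype.ext t.2
    have h2 : IteratedTwist P xs (T ⧸ LinearMap.range c) := by
      refine ih _ (h.trans (sup_le_sup_right (sup_le ?_ ?_) _))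
      · refine fun a ha ↦ Module.mem_annihilator.2 fun t ↦ ?_
        obtain ⟨t, rfl⟩ := Submodule.mkQ_surjective _ t
        rw [← map_smul, Module.mem_annihilator.1 ha t, map_zero]
      · rw [Ideal.span_singleton_le_iff_mem, Module.mem_annihilator]
        intro t
        obtain ⟨t, rfl⟩ := Submodule.mkQ_surjective _ t
        exact (Submodule.Quotient.mk_eq_zero _).2 ⟨t, rfl⟩
    obtain ⟨m, π, hπ⟩ := Module.Finite.exists_fin' S T
    let q := (LinearMap.range c).mkQ ∘ₗ π
    have h3 : IteratedTwist P xs (LinearMap.ker q) :=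
      hQ.syzygy (f := (LinearMap.ker q).subtype) (g := q) Subtype.val_injective
        (LinearMap.exact_subtype_ker_map q) ((Submodule.mkQ_surjective _).comp hπ) h2
    refine ⟨m, π, hπ, ?_⟩
    let i : LinearMap.ker c →ₗ[S] LinearMap.ker (π.coprod c) :=
      LinearMap.codRestrict _ (LinearMap.inr S _ _ ∘ₗ (LinearMap.ker c).subtype) fun t ↦ by
        have : c t.1 = 0 := t.2
        simp [this]
    let p : LinearMap.ker (π.coprod c) →ₗ[S] LinearMap.ker q :=
      LinearMap.codRestrict _ (LinearMap.fst S _ _ ∘ₗ (LinearMap.ker (π.coprod c)).subtype)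
        fun t ↦ by
          have h1 : π t.1.1 + c t.1.2 = 0 := t.2
          refine (Submodule.Quotient.mk_eq_zero _).2 ⟨-t.1.2, ?_⟩
          rw [map_neg]
          exact (eq_neg_of_add_eq_zero_left h1).symm
    refine hQ.extension (f := i) (g := p) ?_ ?_ ?_ h1 h3
    · exact fun s t h ↦ Subtype.ext (congrArg (fun y ↦ y.1.2) h)
    · rintro ⟨⟨a, t⟩, ht⟩
      have ht' : π a + c t = 0 := ht
      constructor
      · intro h
        have ha : a = 0 := congrArg Subtype.val h
        subst ha
        rw [map_zero, zero_add] at ht'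
        exact ⟨⟨t, ht'⟩, rfl⟩
      · rintro ⟨s, hs⟩
        rw [← hs]
        rfl
    · rintro ⟨a, ha⟩
      obtain ⟨t, ht⟩ := (Submodule.Quotient.mk_eq_zero _).1 ha
      refine ⟨⟨(a, -t), ?_⟩, rfl⟩
      change π a + c (-t) = 0
      rw [map_neg, ht]
      exact add_neg_cancel _

/-- If x stably annihilates T, it lifts through the cover π. The twisted kernel then splits as ker π
× T, with ker π in D, so each twist can be undone. -/
theorem IsSyzygyClosed.of_iteratedTwist [IsNoetherianRing S] (hD : IsKernelClosed D)
    (hP : IsSyzygyClosed D P) {T : Type u} [AddCommGroup T] [Module S T] (hT : D T) (xs : List S)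
    (hxs : ∀ x ∈ xs, x ∈ stableAnnihilator S T) (h : IteratedTwist P xs T) : P T := by
  induction xs with
  | nil => exact h
  | cons x xs ih =>
    refine ih (fun y hy ↦ hxs y (List.mem_cons_of_mem _ hy)) ?_
    obtain ⟨m, π, hπ, h⟩ := h
    have hQ := hP.iteratedTwist hD xs
    obtain ⟨σ, hσ⟩ := exists_lift_of_mem_stableAnnihilator (hxs x List.mem_cons_self) hπ
    exact hQ.cancel (hD.ker hπ hD.free hT)
      (hQ.congr (LinearMap.kerCoprodEquivOfFactor π _ σ hσ ≪≫ₗ LinearEquiv.prodComm S _ _) h)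

end Twist

/-! ### Descent up to a complement in D. -/

section StableDescent

open scoped TensorProduct

/-- By flatness the base change of a syzygy is a syzygy of the base change, and a syzygy inherits
the stable annihilator. -/
theorem HasDescent.exists_cover {R S : Type u} [CommRing R] [IsLocalRing R] [IsNoetherianRing R]
    [CommRing S] [Algebra R S] [Module.Flat R S] {X : Type u} [AddCommGroup X] [Module S X]
    (h : HasDescent R S X) :
    ∃ (m : ℕ) (q : (S ⊗[R] (Fin m → R)) →ₗ[S] X), Function.Surjective q ∧
      HasDescent R S (LinearMap.ker q) := by
  obtain ⟨M, _, _, _, ⟨k, hk⟩, ⟨e⟩⟩ := h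
  obtain ⟨m, p, hp⟩ := Module.Finite.exists_fin' R M
  let i := (LinearMap.ker p).subtype
  have hi : Function.Injective i := Subtype.val_injective
  have hip : Function.Exact i p := LinearMap.exact_subtype_ker_map p
  have hiS : Function.Exact (i.baseChange S) (p.baseChange S) := lTensor_exact S hip hp
  have hiSinj : Function.Injective (i.baseChange S) :=
    Module.Flat.lTensor_preserves_injective_linearMap (M := S) i hi
  have hex : Function.Exact (i.baseChange S) (e.toLinearMap ∘ₗ p.baseChange S) := fun t ↦ by
    rw [← hiS t]
    exact e.map_eq_zero_iff
  refine ⟨m, e.toLinearMap ∘ₗ p.baseChange S,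
    e.surjective.comp (LinearMap.lTensor_surjective S hp), LinearMap.ker p, inferInstance,
    inferInstance, inferInstance,
    ⟨k, hk.trans (stableAnnihilator_le_of_exact_of_free hi hip hp)⟩, ⟨hex.kerEquiv hiSinj⟩⟩

/-- `X` becomes the base change of a finitely generated `R`-module that is free on the punctured
spectrum after adding a module in the class `D`. -/
def HasStableDescent (R : Type u) {S : Type u} [CommRing R] [IsLocalRing R] [CommRing S]
    [Algebra R S] (D : ∀ (X : Type u) [AddCommGroup X] [Module S X], Prop) (X : Type u)
    [AddCommGroup X] [Module S X] : Prop :=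
  ∃ (Y : Type u) (_ : AddCommGroup Y) (_ : Module S Y), D Y ∧ HasDescent R S (X × Y)

variable {R S : Type u} [CommRing R] [IsLocalRing R] [IsNoetherianRing R]
  [CommRing S] [Algebra R S] [Module.Flat R S]
  {D : ∀ (X : Type u) [AddCommGroup X] [Module S X], Prop}

theorem HasStableDescent.isSyzygyClosed (hD : IsKernelClosed D)
    (hd : ∀ (k : ℕ) (s : S), ∃ r : R,
      s - algebraMap R S r ∈ (maximalIdeal R ^ k).map (algebraMap R S)) :
    IsSyzygyClosed D (HasStableDescent R D) where
  free := ⟨PUnit, inferInstance, inferInstance, hD.free, HasDescent.of_free⟩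
  extension {A E B} _ _ _ _ _ _ f g hf hfg hg := by
    rintro ⟨Y, _, _, hY, hA⟩ ⟨Z, _, _, hZ, hB⟩
    exact ⟨Y × Z, inferInstance, inferInstance, hD.prod hY hZ,
      HasDescent.of_exact hd (f := f.prodMap (LinearMap.inl S Y Z))
        (g := g.prodMap (LinearMap.snd S Y Z))
        (hf.prodMap (LinearMap.inl_injective (R := S)))
        (hfg.prodMap_linearMap (Function.Exact.inl_snd (R := S))) (hg.prodMap (LinearMap.snd_surjective (R := S)))
        hA hB⟩
  syzygy {Z F B} _ _ _ _ _ _ _ _ f g hf hfg hg := by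
    rintro ⟨Y, _, _, hY, hB⟩
    obtain ⟨m, q, hq, hker⟩ := hB.exists_cover
    have := hD.finite hY
    obtain ⟨n, ρ, hρ⟩ := Module.Finite.exists_fin' S Y
    have hgρ : Function.Surjective (g.prodMap ρ) := hg.prodMap hρ
    -- Schanuel compares the cover of B × Y that comes from R with the product of g and ρ; the
    -- kernel of ρ and the free module coming from R form the new complement.
    obtain ⟨e⟩ := LinearMap.nonempty_ker_prod_equiv hgρ hq
    refine ⟨LinearMap.ker ρ × (S ⊗[R] (Fin m → R)), inferInstance, inferInstance,
      hD.prod (hD.ker hρ hD.free hY) hD.free, ?_⟩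
    have h1 : HasDescent R S (LinearMap.ker q × (F × (Fin n → S))) :=
      HasDescent.of_exact hd LinearMap.inl_injective Function.Exact.inl_snd
        LinearMap.snd_surjective hker HasDescent.of_free
    exact h1.congr (e.symm ≪≫ₗ LinearEquiv.prodCongr ((LinearMap.kerProdMapEquiv g ρ) ≪≫ₗ
      LinearEquiv.prodCongr (hfg.kerEquiv hf).symm (LinearEquiv.refl S _)) (LinearEquiv.refl S _)
      ≪≫ₗ LinearEquiv.prodAssoc S _ _ _)
  cancel {X Y} _ _ _ _ hY := by
    rintro ⟨Z, _, _, hZ, h⟩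
    exact ⟨Y × Z, inferInstance, inferInstance, hD.prod hY hZ,
      h.congr (LinearEquiv.prodAssoc S _ _ _)⟩

/-- A finite module in the class `D` whose stable annihilator contains a power of the maximal
ideal of `R` descends after adding a module in the class `D`. -/
theorem HasStableDescent.of_pow_le_stableAnnihilator [IsNoetherianRing S] (hD : IsKernelClosed D)
    (hd : ∀ (k : ℕ) (s : S), ∃ r : R,
      s - algebraMap R S r ∈ (maximalIdeal R ^ k).map (algebraMap R S))
    {N : Type u} [AddCommGroup N] [Module S N] (hN : D N) (k : ℕ)
    (hk : (maximalIdeal R ^ k).map (algebraMap R S) ≤ stableAnnihilator S N) :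
    HasStableDescent R D N := by
  have hP := HasStableDescent.isSyzygyClosed hD hd
  have := hD.finite hN
  obtain ⟨G, hG⟩ := (IsNoetherian.noetherian ((maximalIdeal R ^ k).map (algebraMap R S)))
  have hG' : Ideal.ofList G.toList = (maximalIdeal R ^ k).map (algebraMap R S) := by
    rw [← hG, Ideal.ofList]
    congr 1
    ext; simp
  refine hP.of_iteratedTwist hD hN G.toList (fun x hx ↦ hk ?_)
    (hP.iteratedTwist_of_le hD (I := (maximalIdeal R ^ k).map (algebraMap R S))
      (fun X _ _ _ hX ↦ ?_) _ _ (hG'.ge.trans le_sup_right))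
  · rw [← hG]
    exact Submodule.subset_span (by simpa using hx)
  · refine ⟨PUnit, inferInstance, inferInstance, hD.free, ?_⟩
    refine HasDescent.of_pow_le_annihilator k (hd k) fun a ha ↦ Module.mem_annihilator.2 ?_
    exact fun x ↦ Prod.ext (Module.mem_annihilator.1 (hX ha) x.1) rfl

end StableDescent

/-! ### The class of modules of bounded depth, and the theorem. -/

theorem ExtResidueVanish.isKernelClosed {S : Type u} [CommRing S] [IsLocalRing S]
    [IsNoetherianRing S] {n : ℕ} (hS : ExtResidueVanish S n S) :
    IsKernelClosed fun (X : Type u) [AddCommGroup X] [Module S X] ↦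
      Module.Finite S X ∧ ExtResidueVanish S n X where
  finite h := h.1
  free := ⟨inferInstance, ExtResidueVanish.of_free hS⟩
  prod hX hY := by
    have := hX.1
    have := hY.1
    exact ⟨inferInstance, hX.2.prod hY.2⟩
  ker {X Y} _ _ _ _ f hf hX hY := by
    have := hX.1
    exact ⟨inferInstance, ExtResidueVanish.of_exact_left (f := (LinearMap.ker f).subtype) (g := f)
      Subtype.val_injective (LinearMap.exact_subtype_ker_map f) hf hX.2 hY.2⟩

theorem moduleDepth_prod_of_le {S : Type u} [CommRing S] [IsLocalRing S] [IsNoetherianRing S]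
    {X Y : Type u} [AddCommGroup X] [Module S X] [Module.Finite S X] [AddCommGroup Y] [Module S Y]
    [Module.Finite S Y] (h : moduleDepth S X ≤ moduleDepth S Y) :
    moduleDepth S (X × Y) = moduleDepth S X := by
  refine ENat.eq_of_forall_natCast_le_iff fun n ↦ ⟨fun hn ↦ ?_, fun hn ↦ ?_⟩
  · exact le_moduleDepth_iff.2 (ExtResidueVanish.of_retract (LinearMap.inl S X Y)
      (LinearMap.fst S X Y) (LinearMap.fst_comp_inl ..) (le_moduleDepth_iff.1 hn))
  · exact le_moduleDepth_iff.2
      ((le_moduleDepth_iff.1 hn).prod (le_moduleDepth_iff.1 (hn.trans h)))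

theorem IsIsoToDirectSummand.of_prod_equiv {A : Type*} [CommRing A] {N N' Y M : Type*}
    [AddCommGroup N] [Module A N] [AddCommGroup N'] [Module A N'] [AddCommGroup Y] [Module A Y]
    [AddCommGroup M] [Module A M] (e₀ : N ≃ₗ[A] N') (e : (N' × Y) ≃ₗ[A] M) :
    IsIsoToDirectSummand A N M := by
  refine ⟨(LinearMap.range (LinearMap.inl A N' Y)).map e.toLinearMap,
    (LinearMap.range (LinearMap.inr A N' Y)).map e.toLinearMap, ?_, ⟨?_⟩⟩
  · exact (LinearMap.isCompl_range_inl_inr (R := A)).map (Submodule.orderIsoMapComap e)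
  · exact e₀ ≪≫ₗ LinearEquiv.ofInjective _ LinearMap.inl_injective ≪≫ₗ
      e.submoduleMap (LinearMap.range (LinearMap.inl A N' Y))

theorem theorem2p2 {R : Type u} [CommRing R] [IsLocalRing R] [IsNoetherianRing R]
    (hR : IsCohenMacaulayLocal R)
    (N : Type v) [AddCommGroup N] [Module (AdicCompletion (maximalIdeal R) R) N]
    [Module.Finite (AdicCompletion (maximalIdeal R) R) N]
    (hN : IsFreeOnPuncturedSpectrum (AdicCompletion (maximalIdeal R) R) N) :
    ∃ (M : Type u) (_ : AddCommGroup M) (_ : Module R M),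
      Module.Finite R M ∧
      IsFreeOnPuncturedSpectrum R M ∧
      moduleDepth R M = moduleDepth (AdicCompletion (maximalIdeal R) R) N ∧
      IsIsoToDirectSummand (AdicCompletion (maximalIdeal R) R) N
        (AdicCompletion (maximalIdeal R) M) := by
  let S := AdicCompletion (maximalIdeal R) R
  have : IsNoetherianRing S := AdicCompletion.isNoetherianRing (maximalIdeal R)
  have : Module.Flat R S := AdicCompletion.flat_of_isNoetherian (maximalIdeal R)
  have hmap : (maximalIdeal R).map (algebraMap R S) = maximalIdeal S :=
    (AdicCompletion.maximalIdeal_eq_map).symm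
  have : IsLocalHom (algebraMap R S) :=
    ((IsLocalRing.local_hom_TFAE (algebraMap R S)).out 0 2).2 hmap.le
  have : Module.FaithfullyFlat R S := Module.FaithfullyFlat.of_flat_of_isLocalHom
  have hd (k : ℕ) (s : S) : ∃ r : R,
      s - algebraMap R S r ∈ (maximalIdeal R ^ k).map (algebraMap R S) :=
    AdicCompletion.exists_sub_algebraMap_mem_of_fg (IsNoetherian.noetherian _) k s
  obtain ⟨m, π, hπ⟩ := Module.Finite.exists_fin' S N
  -- A copy of N in the universe of R, as needed by the Ext arguments and the class D.
  let N' := (Fin m → S) ⧸ LinearMap.ker π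
  let e₀ : N ≃ₗ[S] N' := (π.quotKerEquivOfSurjective hπ).symm
  obtain ⟨k, hk⟩ := isFreeOnPuncturedSpectrum_iff.1 hN
  have hk' : (maximalIdeal R ^ k).map (algebraMap R S) ≤ stableAnnihilator S N' := by
    rw [Ideal.map_pow, hmap]
    exact hk.trans (stableAnnihilator_le_of_equiv e₀)
  have key : ∃ (Y : Type u) (_ : AddCommGroup Y) (_ : Module S Y), Module.Finite S Y ∧
      moduleDepth S N' ≤ moduleDepth S Y ∧ HasDescent R S (N' × Y) := by
    rcases subsingleton_or_nontrivial N' with h | h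
    · refine ⟨PUnit, inferInstance, inferInstance, inferInstance, ?_, HasDescent.of_free⟩
      rw [moduleDepth_eq_top_of_subsingleton (M := PUnit.{u + 1})]
      exact le_top
    · have hle : moduleDepth S N' ≤ moduleDepth S S := by
        -- The chain is depth N' ≤ dim S ≤ dim R = depth R, the equality being the Cohen–Macaulay
        -- hypothesis; depth R = depth S by base change.
        have h1 : (moduleDepth S N' : WithBot ℕ∞) ≤ (moduleDepth R R : WithBot ℕ∞) := by
          rw [show (moduleDepth R R : WithBot ℕ∞) = ringKrullDim R from hR]
          exact moduleDepth_le_ringKrullDim.trans AdicCompletion.ringKrullDim_le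
        rw [← moduleDepth_congr (TensorProduct.AlgebraTensorModule.rid R S S),
          moduleDepth_tensorProduct hmap]
        exact WithBot.coe_le_coe.1 h1
      have hfin : moduleDepth S N' ≠ ⊤ := fun htop ↦ by
        have h1 : ((⊤ : ℕ∞) : WithBot ℕ∞) ≤ ringKrullDim S :=
          htop ▸ moduleDepth_le_ringKrullDim (A := S) (M := N')
        exact absurd (lt_of_le_of_lt h1 ringKrullDim_lt_top) (lt_irrefl _)
      obtain ⟨n, hn⟩ := ENat.ne_top_iff_exists.1 hfin
      have hS : ExtResidueVanish S n S := le_moduleDepth_iff.1 (hn ▸ hle)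
      obtain ⟨Y, _, _, ⟨_, hY⟩, hdesc⟩ := HasStableDescent.of_pow_le_stableAnnihilator
        hS.isKernelClosed hd ⟨inferInstance, le_moduleDepth_iff.1 hn.le⟩ k hk'
      exact ⟨Y, inferInstance, inferInstance, inferInstance, hn ▸ le_moduleDepth_iff.2 hY, hdesc⟩
  obtain ⟨Y, _, _, _, hY, M, _, _, _, hM, ⟨e⟩⟩ := key
  refine ⟨M, inferInstance, inferInstance, inferInstance, isFreeOnPuncturedSpectrum_iff.2 hM, ?_,
    IsIsoToDirectSummand.of_prod_equiv e₀ (e.symm ≪≫ₗ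
      AdicCompletion.ofTensorProductEquivOfFiniteNoetherian (maximalIdeal R) M)⟩
  rw [← moduleDepth_tensorProduct (S := S) hmap, moduleDepth_congr e, moduleDepth_prod_of_le hY,
    ← moduleDepth_congr e₀]
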